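/- Let $F$ be a field of characteristic $0$ (for instance $F=\mathbb C$) and $n\ge 0$. An *exp-polynomial function* $\mathbb Z^r\to F$ in the variables $n_1,\dots,n_r$ is an element of the $F$-algebra of functions generated by the functions $n_j$ and $a^{n_j}$ ($a\in F\setminus\{0\}$, $1\le j\le r$). Let $G=\bigoplus_{\alpha\in\mathbb Z^n}G_\alpha$ be a $\mathbb Z^n$-graded Lie algebra over $F$ which is a *$\mathbb Z^n$-extragraded exp-polynomial Lie algebra*. This means the following. - $G$ is spanned by elements $g_k(\alpha)\in G_\alpha$ ($k\in K$, $\alpha\in\mathbb Z^n$), and there are exp-polynomial functions $f_{k,r}^s(\alpha,\beta)$ in $2n$ variables ($k,r,s\in K$), for fixed $k,r$ nonzero for only finitely many $s$, with $$[g_k(\alpha),g_r(\beta)]=\sum_{s\in K} f_{k,r}^s(\alpha,\beta)\,g_s(\alpha+\beta)\qquad\text{for all }k,r\in K,\ \alpha,\beta\in\mathbb Z^n .$$ - $G$ has a further Lie algebra grading $G=\bigoplus_{i\in\mathbb Z}G^{(i)}$, and $K$ is a disjoint union of finite sets $K_i$ ($i\in\mathbb Z$) such that, for each $i$, the elements $g_k(\alpha)$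 with $k\in K_i$, $\alpha\in\mathbb Z^n$ lie in $G^{(i)}$ and span $G^{(i)}$. Let $J$ be a finite set and let $V$ be a $\mathbb Z^n$-graded exp-polynomial $G^{(0)}$-module: $V$ is a $G^{(0)}$-module with a basis $v_j(\alpha)$ ($j\in J$, $\alpha\in\mathbb Z^n$), and there are exp-polynomial functions $h_{k,j}^s(\alpha,\beta)$ in $2n$ variables with $$g_k(\alpha)v_j(\beta)=\sum_{s\in J}h_{k,j}^s(\alpha,\beta)\,v_s(\alpha+\beta)\qquad\text{for all }k\in K_0,\ j\in J,\ \alpha,\beta\in\mathbb Z^n .$$ Put $V_\alpha=\operatorname{span}\{v_j(\alpha)\mid j\in J\}$. Let $G^+=\bigoplus_{i\ge1}G^{(i)}$ act on $V$ by zero, and let $\widetilde M(V)=\operatorname{Ind}^G_{G^{(0)}+G^+}V=U(G)\otimes_{U(G^{(0)}+G^+)}V$. For $(i,\alpha)\in\mathbb Z\times\mathbb Z^n$ let $\widetilde M(V)^{(i)}_\alpha$ be the span of the elements $x_1\cdots x_s\otimes y$ with $s\ge0$, $x_p\in G^{(i_p)}\cap G_{\alpha_p}$, $y\in V_\beta$,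 $i_1+\dots+i_s=i$ and $\alpha_1+\dots+\alpha_s+\beta=\alpha$; a submodule of $\widetilde M(V)$ is called graded if each of its elements is a sum of elements of it that lie in these components. Then the sum $\widetilde M^{rad}$ of all graded submodules of $\widetilde M(V)$ which intersect $V=1\otimes V$ trivially is itself such a submodule, that is, it is the largest one. Let $M(V)=\widetilde M(V)/\widetilde M^{rad}$, and let $M(V)^{(i)}_\alpha$ be the image of $\widetilde M(V)^{(i)}_\alpha$. Then $$M(V)=\bigoplus_{(i,\alpha)\in\mathbb Z\times\mathbb Z^n}M(V)^{(i)}_\alpha\qquad\text{and}\qquad \dim M(V)^{(i)}_\alpha<\infty\quad\text{for all } i\in\mathbb Z,\ \alpha\in\mathbb Z^n .$$ -/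

import Mathlib

open scoped DirectSum TensorProduct

noncomputable section

namespace ExpPolyLie

attribute [local instance] LieRing.ofAssociativeRing

/-! ### Exp-polynomial functions, Lie algebras and modules -/

section ExpPoly

/-- The algebra of exp-polynomial functions `ℤ^ι → F` in the variables `n_j`, `j ∈ ι`: it is
generated by the functions `n ↦ n_j` and `n ↦ a ^ n_j` with `a ∈ F \ {0}`. -/
def expPolynomial (F : Type*) [Field F] (ι : Type*) : Subalgebra F ((ι → ℤ) → F) :=
  Algebra.adjoin F
    (Set.range (fun (j : ι) (n : ι → ℤ) => (n j : F)) ∪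
      Set.range (fun (p : Fˣ × ι) (n : ι → ℤ) => (p.1 : F) ^ n p.2))

/-- Exp-polynomial functions in `2n` variables, grouped as `(α, β) ∈ ℤⁿ × ℤⁿ`. -/
abbrev ExpPoly₂ (F : Type*) [Field F] (n : ℕ) : Type _ := expPolynomial F (Fin n ⊕ Fin n)

/-- The value `f(α, β)`. -/
def ExpPoly₂.eval {F : Type*} [Field F] {n : ℕ} (f : ExpPoly₂ F n) (α β : Fin n → ℤ) : F :=
  (f : (Fin n ⊕ Fin n → ℤ) → F) (Sum.elim α β)

/-- The family `g_k(α)`, `k ∈ K`, `α ∈ ℤⁿ`, is a distinguished spanning set which makes the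
`ℤⁿ`-graded Lie algebra `G = ⨁ 𝒜 α` an exp-polynomial Lie algebra. The structure functions
`f_{k,r}^s`, of which for given `k, r` only finitely many are nonzero, are recorded as a finitely
supported function of `s`. -/
structure IsExpPolynomialLie {F G : Type*} [Field F] [LieRing G] [LieAlgebra F G] {n : ℕ}
    (𝒜 : (Fin n → ℤ) → Submodule F G) [GradedLieAlgebra 𝒜] {K : Type*}
    (g : K → (Fin n → ℤ) → G) : Prop where
  mem : ∀ k α, g k α ∈ 𝒜 α
  span_eq_top : Submodule.span F {x | ∃ k α, x = g k α} = ⊤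
  exists_structure : ∃ f : K → K → K →₀ ExpPoly₂ F n, ∀ k r α β,
    ⁅g k α, g r β⁆ = (f k r).sum fun s c => c.eval α β • g s (α + β)

/-- The module `V` over the Lie algebra `L` with distinguished spanning set `g_k(α)` is a
`ℤⁿ`-graded exp-polynomial module with respect to its basis `v_j(β)`, `j ∈ J`, `β ∈ ℤⁿ`.
Here `J` may be infinite. -/
def IsExpPolynomialModule {F L V : Type*} [Field F] [LieRing L] [LieAlgebra F L]
    [AddCommGroup V] [Module F V] [LieRingModule L V] [LieModule F L V] {n : ℕ} {K J : Type*}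
    (g : K → (Fin n → ℤ) → L) (v : Module.Basis (J × (Fin n → ℤ)) F V) : Prop :=
  ∃ h : K → J → J →₀ ExpPoly₂ F n, ∀ k j α β,
    ⁅g k α, v (j, β)⁆ = (h k j).sum fun s c => c.eval α β • v (s, α + β)

/-- The homogeneous component `V_α`, spanned by the `v_j(α)`, `j ∈ J`. -/
def moduleComponent {F V : Type*} [Field F] [AddCommGroup V] [Module F V] {n : ℕ} {J : Type*}
    (v : Module.Basis (J × (Fin n → ℤ)) F V) (α : Fin n → ℤ) : Submodule F V :=
  Submodule.span F (Set.range fun j => v (j, α))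

/-- The exp-polynomial Lie algebra `G` with its distinguished spanning set `g_k(α)` is
`ℤⁿ`-extragraded: there is a further `ℤ`-grading `G = ⨁ ℬ i`, and `K` is the disjoint union of the
finite sets `K_i = {k | deg k = i}`, such that the `g_k(α)` with `k ∈ K_i` lie in `ℬ i` and
span it. -/
structure IsExtragraded {F G : Type*} [Field F] [LieRing G] [LieAlgebra F G] {n : ℕ}
    (𝒜 : (Fin n → ℤ) → Submodule F G) [GradedLieAlgebra 𝒜]
    (ℬ : ℤ → Submodule F G) [GradedLieAlgebra ℬ] {K : Type*}
    (g : K → (Fin n → ℤ) → G) (deg : K → ℤ) : Prop where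
  isExpPolynomialLie : IsExpPolynomialLie 𝒜 g
  finite_deg : ∀ i, {k | deg k = i}.Finite
  mem : ∀ k α, g k α ∈ ℬ (deg k)
  span_eq : ∀ i, Submodule.span F {x | ∃ k α, deg k = i ∧ x = g k α} = ℬ i

end ExpPoly

/-! ### The subalgebras `G⁽⁰⁾` and `G⁽⁰⁾ + G⁺` of a `ℤ`-graded Lie algebra -/

section Parts

variable {F G : Type*} [Field F] [LieRing G] [LieAlgebra F G]
  (ℬ : ℤ → Submodule F G) [GradedLieAlgebra ℬ]

/-- The subalgebra `G⁽⁰⁾`. -/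
def zeroPart : LieSubalgebra F G :=
  { ℬ 0 with
    lie_mem' := fun {x y} hx hy => by
      have h := SetLike.GradedBracket.bracket_mem (ℒ := ℬ) (i := 0) (j := 0) hx hy
      simpa using h }

/-- The subalgebra `G⁽⁰⁾ + G⁺`, where `G⁺ = ⨁_{i ≥ 1} G⁽ⁱ⁾`. -/
def nonnegPart : LieSubalgebra F G :=
  { ℬ 0 ⊔ ⨆ i : {i : ℤ // 1 ≤ i}, ℬ i with
    lie_mem' := fun {x y} hx hy => by
      have key : (ℬ 0 ⊔ ⨆ i : {i : ℤ // 1 ≤ i}, ℬ i) = ⨆ i : {i : ℤ // 0 ≤ i}, ℬ i := by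
        apply le_antisymm
        · refine sup_le (le_iSup (fun i : {i : ℤ // 0 ≤ i} => ℬ i) ⟨0, le_rfl⟩) ?_
          refine iSup_le fun i => ?_
          exact le_iSup (fun i : {i : ℤ // 0 ≤ i} => ℬ i) ⟨i.1, by have := i.2; omega⟩
        · refine iSup_le fun i => ?_
          rcases eq_or_lt_of_le i.2 with h | h
          · rw [← h]; exact le_sup_left
          · exact le_sup_of_le_right
              (le_iSup (fun i : {i : ℤ // 1 ≤ i} => ℬ i) ⟨i.1, by omega⟩)
      change ⁅x, y⁆ ∈ (ℬ 0 ⊔ ⨆ i : {i : ℤ // 1 ≤ i}, ℬ i)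
      change x ∈ (ℬ 0 ⊔ ⨆ i : {i : ℤ // 1 ≤ i}, ℬ i) at hx
      change y ∈ (ℬ 0 ⊔ ⨆ i : {i : ℤ // 1 ≤ i}, ℬ i) at hy
      rw [key] at hx hy ⊢
      induction hx using Submodule.iSup_induction' with
      | mem i x hx =>
        induction hy using Submodule.iSup_induction' with
        | mem j y hy =>
          exact Submodule.mem_iSup_of_mem
            (⟨i.1 + j.1, add_nonneg i.2 j.2⟩ : {i : ℤ // 0 ≤ i})
            (SetLike.GradedBracket.bracket_mem (ℒ := ℬ) hx hy)
        | zero => simp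
        | add y z _ _ hy hz => rw [lie_add]; exact add_mem hy hz
      | zero => simp
      | add x z _ _ hx hz => rw [add_lie]; exact add_mem hx hz }

/-- The component of degree `0`, as a linear map `G → G⁽⁰⁾`. -/
def zeroComponent : G →ₗ[F] zeroPart ℬ :=
  (DirectSum.component F ℤ (fun i => ℬ i) 0).comp
    (DirectSum.decomposeLinearEquiv ℬ).toLinearMap

lemma coe_zeroComponent (x : G) :
    (zeroComponent ℬ x : G) = (DirectSum.decompose ℬ x 0 : G) := rfl

lemma zeroComponent_of_mem {x : G} (hx : x ∈ ℬ 0) : (zeroComponent ℬ x : G) = x := by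
  rw [coe_zeroComponent, DirectSum.decompose_of_mem_same ℬ hx]

lemma zeroComponent_of_mem_ne {x : G} {i : ℤ} (hx : x ∈ ℬ i) (hi : i ≠ 0) :
    zeroComponent ℬ x = 0 := by
  apply Subtype.ext
  rw [coe_zeroComponent, DirectSum.decompose_of_mem_ne ℬ hx hi]
  rfl

lemma zeroComponent_of_mem_iSup {x : G} (hx : x ∈ ⨆ i : {i : ℤ // 1 ≤ i}, ℬ i) :
    zeroComponent ℬ x = 0 := by
  induction hx using Submodule.iSup_induction' with
  | mem i x hx => exact zeroComponent_of_mem_ne ℬ hx (by have := i.2; omega)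
  | zero => simp
  | add x z _ _ hx hz => simp [hx, hz]

/-- On `G⁽⁰⁾ + G⁺` the projection onto `G⁽⁰⁾` with kernel `G⁺` is a homomorphism of Lie
algebras. -/
def nonnegToZero : nonnegPart ℬ →ₗ⁅F⁆ zeroPart ℬ :=
  { (zeroComponent ℬ).comp (nonnegPart ℬ).toSubmodule.subtype with
    map_lie' := fun {x y} => by
      have key : ∀ {i j : ℤ} {a b : G}, 0 ≤ i → 0 ≤ j → a ∈ ℬ i → b ∈ ℬ j →
          zeroComponent ℬ ⁅a, b⁆ = ⁅zeroComponent ℬ a, zeroComponent ℬ b⁆ := by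
        intro i j a b hi hj ha hb
        have hab := SetLike.GradedBracket.bracket_mem (ℒ := ℬ) ha hb
        by_cases h0 : i = 0
        · by_cases h1 : j = 0
          · subst h0; subst h1
            apply Subtype.ext
            rw [LieSubalgebra.coe_bracket, zeroComponent_of_mem ℬ ha, zeroComponent_of_mem ℬ hb]
            exact zeroComponent_of_mem ℬ (by simpa using hab)
          · rw [zeroComponent_of_mem_ne ℬ hb h1, lie_zero]
            exact zeroComponent_of_mem_ne ℬ hab (by omega)
        · rw [zeroComponent_of_mem_ne ℬ ha h0, zero_lie]
          exact zeroComponent_of_mem_ne ℬ hab (by omega)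
      have main : ∀ a ∈ (ℬ 0 ⊔ ⨆ i : {i : ℤ // 1 ≤ i}, ℬ i),
          ∀ b ∈ (ℬ 0 ⊔ ⨆ i : {i : ℤ // 1 ≤ i}, ℬ i),
          zeroComponent ℬ ⁅a, b⁆ = ⁅zeroComponent ℬ a, zeroComponent ℬ b⁆ := by
        have left : ∀ {j : ℤ} {b : G}, 0 ≤ j → b ∈ ℬ j →
            ∀ a ∈ (ℬ 0 ⊔ ⨆ i : {i : ℤ // 1 ≤ i}, ℬ i),
            zeroComponent ℬ ⁅a, b⁆ = ⁅zeroComponent ℬ a, zeroComponent ℬ b⁆ := by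
          intro j b hj hb a ha
          obtain ⟨a₀, ha₀, a₁, ha₁, rfl⟩ := Submodule.mem_sup.1 ha
          have h₁ : zeroComponent ℬ ⁅a₁, b⁆ = ⁅zeroComponent ℬ a₁, zeroComponent ℬ b⁆ := by
            induction ha₁ using Submodule.iSup_induction' with
            | mem i x hx => exact key (by have := i.2; omega) hj hx hb
            | zero => simp
            | add x z hx' hz' hx hz =>
              rw [add_lie, map_add, map_add, add_lie,
                hx (Submodule.add_mem_sup ha₀ hx'), hz (Submodule.add_mem_sup ha₀ hz')]
          rw [add_lie, map_add, map_add, add_lie, h₁, key le_rfl hj ha₀ hb]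
        intro a ha b hb
        obtain ⟨b₀, hb₀, b₁, hb₁, rfl⟩ := Submodule.mem_sup.1 hb
        have h₁ : zeroComponent ℬ ⁅a, b₁⁆ = ⁅zeroComponent ℬ a, zeroComponent ℬ b₁⁆ := by
          induction hb₁ using Submodule.iSup_induction' with
          | mem i x hx => exact left (by have := i.2; omega) hx a ha
          | zero => simp
          | add x z hx' hz' hx hz =>
            rw [lie_add, map_add, map_add, lie_add,
              hx (Submodule.add_mem_sup hb₀ hx'), hz (Submodule.add_mem_sup hb₀ hz')]
        rw [lie_add, map_add, map_add, lie_add, h₁, left le_rfl hb₀ a ha]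
      exact main x.1 x.2 y.1 y.2 }

/-- A `G⁽⁰⁾`-module `V`, made into a representation of `G⁽⁰⁾ + G⁺` by letting `G⁺` act by zero. -/
def inflate (V : Type*) [AddCommGroup V] [Module F V] [LieRingModule (zeroPart ℬ) V]
    [LieModule F (zeroPart ℬ) V] : nonnegPart ℬ →ₗ⁅F⁆ Module.End F V :=
  (LieModule.toEnd F (zeroPart ℬ) V).comp (nonnegToZero ℬ)

lemma inflate_apply_zero {V : Type*} [AddCommGroup V] [Module F V]
    [LieRingModule (zeroPart ℬ) V] [LieModule F (zeroPart ℬ) V] (x : G) (hx : x ∈ ℬ 0) (y : V) :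
    inflate ℬ V ⟨x, Submodule.mem_sup_left hx⟩ y = ⁅(⟨x, hx⟩ : zeroPart ℬ), y⁆ := by
  have h : zeroComponent ℬ x = ⟨x, hx⟩ := Subtype.ext (zeroComponent_of_mem ℬ hx)
  change ⁅zeroComponent ℬ x, y⁆ = _
  rw [h]

lemma inflate_apply_pos {V : Type*} [AddCommGroup V] [Module F V]
    [LieRingModule (zeroPart ℬ) V] [LieModule F (zeroPart ℬ) V] (x : G)
    (hx : x ∈ ⨆ i : {i : ℤ // 1 ≤ i}, ℬ i) (y : V) :
    inflate ℬ V ⟨x, Submodule.mem_sup_right hx⟩ y = 0 := by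
  change ⁅zeroComponent ℬ x, y⁆ = _
  rw [zeroComponent_of_mem_iSup ℬ hx, zero_lie]

/-- The elements `g_k(α)`, `k ∈ K_0`: the distinguished spanning set of `G⁽⁰⁾`. -/
def zeroSpanningSet {n : ℕ} {K : Type*} {g : K → (Fin n → ℤ) → G} {deg : K → ℤ}
    (hg : ∀ k α, g k α ∈ ℬ (deg k)) (k : {k : K // deg k = 0}) (α : Fin n → ℤ) : zeroPart ℬ :=
  ⟨g k.1 α, by
    have h := hg k.1 α
    rw [k.2] at h
    exact h⟩

end Parts

/-! ### The induced module `U(G) ⊗_{U(P)} V` -/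

section Induced

variable {F G : Type*} [Field F] [LieRing G] [LieAlgebra F G]
  {V : Type*} [AddCommGroup V] [Module F V]

/-- The `U(G)`-submodule of `U(G) ⊗_F V` generated by the elements `u x ⊗ v - u ⊗ x v` with `x ∈ P`.
As `P` generates `U(P)`, the quotient by it is `U(G) ⊗_{U(P)} V`. -/
def indRel {P : LieSubalgebra F G} (ρ : P →ₗ⁅F⁆ Module.End F V) :
    Submodule (UniversalEnvelopingAlgebra F G) (UniversalEnvelopingAlgebra F G ⊗[F] V) :=
  Submodule.span _ {t | ∃ (u : UniversalEnvelopingAlgebra F G) (x : P) (y : V),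
    t = (u * UniversalEnvelopingAlgebra.ι F (x : G)) ⊗ₜ[F] y - u ⊗ₜ[F] (ρ x y)}

/-- The induced `G`-module `Ind_P^G V = U(G) ⊗_{U(P)} V`, as a `U(G)`-module, for a subalgebra `P`
of `G` and a representation `ρ` of `P` on `V`. -/
abbrev Ind {P : LieSubalgebra F G} (ρ : P →ₗ⁅F⁆ Module.End F V) : Type _ :=
  (UniversalEnvelopingAlgebra F G ⊗[F] V) ⧸ indRel ρ

/-- The class of `u ⊗ y` in the induced module. -/
def Ind.mk {P : LieSubalgebra F G} (ρ : P →ₗ⁅F⁆ Module.End F V)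
    (u : UniversalEnvelopingAlgebra F G) (y : V) : Ind ρ :=
  (indRel ρ).mkQ (u ⊗ₜ[F] y)

/-- The canonical map `V → Ind_P^G V`, `y ↦ 1 ⊗ y`. -/
def Ind.incl {P : LieSubalgebra F G} (ρ : P →ₗ⁅F⁆ Module.End F V) : V →ₗ[F] Ind ρ :=
  ((indRel ρ).mkQ.restrictScalars F).comp
    (TensorProduct.mk F (UniversalEnvelopingAlgebra F G) V 1)

/-- For a family `𝒢 γ` of subspaces of `G`, the monomial `x_1 ⋯ x_s` in `U(G)` with factors
`x_p ∈ 𝒢 γ_p` has degree `γ_1 + ⋯ + γ_s`; the empty monomial `1` has degree `0`. -/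
inductive IsMonomial {Γ : Type*} [AddMonoid Γ] (𝒢 : Γ → Submodule F G) :
    Γ → UniversalEnvelopingAlgebra F G → Prop
  | one : IsMonomial 𝒢 0 1
  | mul {γ δ : Γ} {x : G} {u : UniversalEnvelopingAlgebra F G} :
      x ∈ 𝒢 γ → IsMonomial 𝒢 δ u → IsMonomial 𝒢 (γ + δ) (UniversalEnvelopingAlgebra.ι F x * u)

/-- The homogeneous component of degree `γ` of the induced module: it is spanned by the classes
of `x_1 ⋯ x_s ⊗ y`, where the degrees of the homogeneous elements `x_1, …, x_s` of `G` and `y` of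
`V` add up to `γ`. -/
def indComponent {Γ : Type*} [AddMonoid Γ] (𝒢 : Γ → Submodule F G) (𝒱 : Γ → Submodule F V)
    {P : LieSubalgebra F G} (ρ : P →ₗ⁅F⁆ Module.End F V) (γ : Γ) : Submodule F (Ind ρ) :=
  Submodule.span F {m | ∃ (δ ε : Γ) (u : UniversalEnvelopingAlgebra F G) (y : V),
    δ + ε = γ ∧ IsMonomial 𝒢 δ u ∧ y ∈ 𝒱 ε ∧ m = Ind.mk ρ u y}

/-- The `G`-submodule `N` of a `G`-module `M` is graded, with respect to the homogeneous components
`ℳ γ` of `M`: every element of `N` is a sum of homogeneous elements of `N`. -/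
def IsGradedSubmodule {Γ M : Type*} [AddCommGroup M] [Module F M]
    [Module (UniversalEnvelopingAlgebra F G) M] [IsScalarTower F (UniversalEnvelopingAlgebra F G) M]
    (ℳ : Γ → Submodule F M) (N : Submodule (UniversalEnvelopingAlgebra F G) M) : Prop :=
  N.restrictScalars F ≤ ⨆ γ, N.restrictScalars F ⊓ ℳ γ

end Induced

/-! ### The modules `M̃(V)` and `M(V)` -/

section Main

variable {F G : Type*} [Field F] [LieRing G] [LieAlgebra F G] {n : ℕ}
  (𝒜 : (Fin n → ℤ) → Submodule F G) (ℬ : ℤ → Submodule F G) [GradedLieAlgebra ℬ]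
  {V : Type*} [AddCommGroup V] [Module F V] [LieRingModule (zeroPart ℬ) V]
  [LieModule F (zeroPart ℬ) V] (𝒱 : (Fin n → ℤ) → Submodule F V)

/-- The components `G⁽ⁱ⁾_α = G⁽ⁱ⁾ ∩ G_α` of the `ℤ^{n+1}`-grading of `G`. -/
def bigrading (γ : ℤ × (Fin n → ℤ)) : Submodule F G := ℬ γ.1 ⊓ 𝒜 γ.2

/-- The space `V`, graded by `ℤ^{n+1}` with `V_α` placed in degree `(0, α)`. -/
def bigradingModule (γ : ℤ × (Fin n → ℤ)) : Submodule F V := if γ.1 = 0 then 𝒱 γ.2 else ⊥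

variable (V) in
/-- The module `M̃(V)` induced from `G⁽⁰⁾ + G⁺` to `G`. -/
abbrev MTilde : Type _ := Ind (inflate ℬ V)

/-- The homogeneous component of `M̃(V)` of degree `γ = (i, α)`. -/
def MTilde.component (γ : ℤ × (Fin n → ℤ)) : Submodule F (MTilde ℬ V) :=
  indComponent (bigrading 𝒜 ℬ) (bigradingModule 𝒱) (inflate ℬ V) γ

/-- `N` is a `ℤ^{n+1}`-graded `G`-submodule of `M̃(V)` which intersects (the image of) `V`
trivially. -/
def IsGradedAvoiding (N : Submodule (UniversalEnvelopingAlgebra F G) (MTilde ℬ V)) : Prop :=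
  IsGradedSubmodule (MTilde.component 𝒜 ℬ 𝒱) N ∧
    N.restrictScalars F ⊓ LinearMap.range (Ind.incl (inflate ℬ V)) = ⊥

/-- The radical of `M̃(V)`: the sum of all graded submodules which intersect `V` trivially. -/
def MTilde.rad : Submodule (UniversalEnvelopingAlgebra F G) (MTilde ℬ V) :=
  sSup {N | IsGradedAvoiding 𝒜 ℬ 𝒱 N}

/-- The quotient module `M(V)` of `M̃(V)` by its radical. -/
abbrev MQuot : Type _ := MTilde ℬ V ⧸ MTilde.rad 𝒜 ℬ 𝒱

/-- The homogeneous component of `M(V)` of degree `γ = (i, α)`: the image of that of `M̃(V)`. -/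
def MQuot.component (γ : ℤ × (Fin n → ℤ)) : Submodule F (MQuot 𝒜 ℬ 𝒱) :=
  (MTilde.component 𝒜 ℬ 𝒱 γ).map ((MTilde.rad 𝒜 ℬ 𝒱).mkQ.restrictScalars F)

end Main

end ExpPolyLie

end

/-!
Write `M̃` and `M` for `M̃(V)` and `M(V)`. The grading of `M̃` comes from an action of `G` on
functions `ℤ^{n+1} → M̃` that shifts degrees: it induces a map `M̃ → (ℤ^{n+1} → M̃)` whose values
are the homogeneous parts. By straightening, `M̃` lives in degrees `i ≤ 0` and equals `V` in
degree `0`, so a graded submodule avoids `V` iff it has no part of degree `0`; hence the sum of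
all of these is again one of them. For the same reason a homogeneous `w ∈ M̃⁽ⁱ⁾` is in the radical
as soon as it is killed by all monomials in raising operators of total degree `-i`.

For the finiteness, `M̃⁽ⁱ⁾_α` is spanned by monomials in lowering operators, applied to the
`v_j(β)`, and there are finitely many possible types of lowering monomials of degree `i` and of
raising monomials of degree `-i`. Given a type of each, apply the raising monomial with labels
`z = (α_1, α_2, …)` to the lowering one with labels `y = (β_1, β_2, …)`. Straightening the product
involves only the structure functions, evaluated at sums of labels, and `a^{p+q} = a^p a^q` and
`p + q` make these functions of `(y, z)` of finite rank. Therefore the functions of `z` obtained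
in this way span a finite-dimensional space, and `M⁽ⁱ⁾_α` embeds into a finite product of such
spaces.
-/

noncomputable section

namespace ExpPolyLie

attribute [local instance] LieRing.ofAssociativeRing

open UniversalEnvelopingAlgebra (ι)

section GradedSpaces

variable {R M Γ : Type*} [Ring R] [AddCommGroup M] [Module R M]

lemma iSup_eq_top_of_span_eq_top {I : Type*} {ℳ : Γ → Submodule R M} {x : I → M} {wt : I → Γ}
    (hx : ∀ i, x i ∈ ℳ (wt i)) (hspan : Submodule.span R (Set.range x) = ⊤) : ⨆ γ, ℳ γ = ⊤ :=
  top_le_iff.1 <| hspan ▸ Submodule.span_le.2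
    (Set.range_subset_iff.2 fun i => Submodule.mem_iSup_of_mem (wt i) (hx i))

lemma inf_biSup_eq_bot_iff_of_isInternal [DecidableEq Γ] {ℳ : Γ → Submodule R M}
    (hℳ : DirectSum.IsInternal ℳ) {N : Submodule R M} (hN : N ≤ ⨆ γ, N ⊓ ℳ γ) (S : Set Γ) :
    N ⊓ ⨆ γ ∈ S, ℳ γ = ⊥ ↔ N ≤ ⨆ γ ∈ Sᶜ, ℳ γ := by
  constructor
  · refine fun h => hN.trans (iSup_le fun γ => ?_)
    by_cases hγ : γ ∈ S
    · exact (inf_le_inf_left N (le_iSup₂ (f := fun γ _ => ℳ γ) γ hγ)).trans (h.trans_le bot_le)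
    · exact inf_le_right.trans (le_iSup₂ (f := fun γ (_ : γ ∈ Sᶜ) => ℳ γ) γ hγ)
  · exact fun h => ((hℳ.submodule_iSupIndep.disjoint_biSup_biSup
      disjoint_compl_left).mono_left h).eq_bot

variable [DecidableEq Γ]

/-- The map sending an element of a graded module to the family of its homogeneous components. -/
def homogeneousParts (ℳ : Γ → Submodule R M) [DirectSum.Decomposition ℳ] : M →ₗ[R] Γ → M :=
  LinearMap.pi fun γ => (ℳ γ).subtype ∘ₗ DirectSum.component R Γ (fun γ => ℳ γ) γ ∘ₗ
    (DirectSum.decomposeLinearEquiv ℳ).toLinearMap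

lemma homogeneousParts_of_mem {ℳ : Γ → Submodule R M} [DirectSum.Decomposition ℳ] {γ : Γ} {m : M}
    (hm : m ∈ ℳ γ) : homogeneousParts ℳ m = Pi.single γ m := by
  funext δ
  change (DirectSum.decompose ℳ m δ : M) = _
  obtain rfl | hδ := eq_or_ne δ γ
  · rw [DirectSum.decompose_of_mem_same ℳ hm, Pi.single_eq_same]
  · rw [DirectSum.decompose_of_mem_ne ℳ hm hδ.symm, Pi.single_eq_of_ne hδ]

lemma isInternal_of_parts {ℳ : Γ → Submodule R M} (D : M →ₗ[R] Γ → M)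
    (hD : ∀ γ, ∀ m ∈ ℳ γ, D m = Pi.single γ m) (htop : ⨆ γ, ℳ γ = ⊤) :
    DirectSum.IsInternal ℳ := by
  refine DirectSum.isInternal_submodule_of_iSupIndep_of_iSup_eq_top (fun γ => ?_) htop
  rw [Submodule.disjoint_def]
  intro m hm hm'
  have hker : ⨆ δ, ⨆ (_ : δ ≠ γ), ℳ δ ≤ LinearMap.ker (LinearMap.proj γ ∘ₗ D) :=
    iSup₂_le fun δ hδ x hx => by simp [hD δ x hx, Pi.single_eq_of_ne hδ.symm]
  simpa [hD γ m hm] using hker hm'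

lemma isInternal_inf {Γ' : Type*} [DecidableEq Γ'] {ℳ : Γ → Submodule R M} {𝒩 : Γ' → Submodule R M}
    [DirectSum.Decomposition ℳ] [DirectSum.Decomposition 𝒩]
    (htop : ⨆ γ : Γ × Γ', ℳ γ.1 ⊓ 𝒩 γ.2 = ⊤) :
    DirectSum.IsInternal fun γ : Γ × Γ' => ℳ γ.1 ⊓ 𝒩 γ.2 := by
  refine isInternal_of_parts (LinearMap.pi fun γ => LinearMap.proj γ.2 ∘ₗ homogeneousParts 𝒩 ∘ₗ
    LinearMap.proj γ.1 ∘ₗ homogeneousParts ℳ) (fun γ m hm => funext fun δ => ?_) htop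
  simp only [LinearMap.pi_apply, LinearMap.comp_apply, LinearMap.proj_apply,
    homogeneousParts_of_mem hm.1]
  obtain h₁ | h₁ := eq_or_ne δ.1 γ.1
  · rw [h₁, Pi.single_eq_same, homogeneousParts_of_mem hm.2]
    obtain h₂ | h₂ := eq_or_ne δ.2 γ.2
    · rw [h₂, Prod.ext h₁ h₂, Pi.single_eq_same, Pi.single_eq_same]
    · rw [Pi.single_eq_of_ne h₂, Pi.single_eq_of_ne fun h => h₂ (congrArg Prod.snd h)]
  · rw [Pi.single_eq_of_ne h₁, Pi.single_eq_of_ne fun h => h₁ (congrArg Prod.fst h), map_zero,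
      Pi.zero_apply]

lemma isInternal_span_basis {I : Type*} (b : Module.Basis I R M) (wt : I → Γ) :
    DirectSum.IsInternal fun γ => Submodule.span R (b '' {i | wt i = γ}) := by
  refine isInternal_of_parts (b.constr ℕ fun i => Pi.single (wt i) (b i)) (fun γ m hm => ?_)
    (iSup_eq_top_of_span_eq_top (fun i => Submodule.subset_span ⟨i, rfl, rfl⟩) b.span_eq)
  induction hm using Submodule.span_induction with
  | mem _ h => obtain ⟨i, rfl, rfl⟩ := h; exact b.constr_basis ℕ _ i
  | zero => rw [map_zero, Pi.single_zero]
  | add x y _ _ hx hy => rw [map_add, hx, hy, Pi.single_add]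
  | smul c x _ hx => rw [map_smul, hx, Pi.single_smul]

lemma le_span_of_span_eq_top {I : Type*} {ℳ : Γ → Submodule R M} [DirectSum.Decomposition ℳ]
    {x : I → M} {wt : I → Γ} (hx : ∀ i, x i ∈ ℳ (wt i))
    (hspan : Submodule.span R (Set.range x) = ⊤) (γ : Γ) :
    ℳ γ ≤ Submodule.span R (x '' {i | wt i = γ}) := by
  have hpart : ⊤ ≤ (Submodule.span R (x '' {i | wt i = γ})).comap
      (LinearMap.proj γ ∘ₗ homogeneousParts ℳ) := by
    rw [← hspan, Submodule.span_le]
    rintro _ ⟨i, rfl⟩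
    have hi : homogeneousParts ℳ (x i) γ = (Pi.single (wt i) (x i) : Γ → M) γ :=
      congrFun (homogeneousParts_of_mem (hx i)) γ
    obtain h | h := eq_or_ne (wt i) γ
    · have hmem : x i ∈ Submodule.span R (x '' {i | wt i = γ}) := Submodule.subset_span ⟨i, h, rfl⟩
      simpa [hi, h] using hmem
    · simp [hi, Pi.single_eq_of_ne h.symm]
  intro m hm
  simpa [homogeneousParts_of_mem hm] using hpart (Submodule.mem_top (x := m))

lemma isInternal_map_of_ker_le {Q : Type*} [AddCommGroup Q] [Module R Q] {ℳ : Γ → Submodule R M}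
    (hℳ : DirectSum.IsInternal ℳ) {q : M →ₗ[R] Q} (hq : Function.Surjective q)
    (hker : LinearMap.ker q ≤ ⨆ γ, LinearMap.ker q ⊓ ℳ γ) :
    DirectSum.IsInternal fun γ => (ℳ γ).map q := by
  let := hℳ.chooseDecomposition
  have hkill : LinearMap.ker q ≤ LinearMap.ker (q.compLeft Γ ∘ₗ homogeneousParts ℳ) :=
    hker.trans <| iSup_le fun γ m hm => by
      have hqm : q m = 0 := hm.1
      ext δ
      simp [homogeneousParts_of_mem hm.2, Pi.apply_single (fun _ => q), hqm]
  refine isInternal_of_parts ((LinearMap.ker q).liftQ _ hkill ∘ₗ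
    (q.quotKerEquivOfSurjective hq).symm.toLinearMap) ?_ ?_
  · rintro γ _ ⟨m, hm, rfl⟩
    have hsymm : (q.quotKerEquivOfSurjective hq).symm (q m) = (LinearMap.ker q).mkQ m :=
      (LinearEquiv.symm_apply_eq _).2 rfl
    ext δ
    simp [hsymm, homogeneousParts_of_mem hm, Pi.apply_single (fun _ => q)]
  · rw [← Submodule.map_iSup, hℳ.submodule_iSup_eq_top, Submodule.map_top,
      LinearMap.range_eq_top.2 hq]

end GradedSpaces

section EnvelopingAlgebra

variable {F G : Type*} [Field F] [LieRing G] [LieAlgebra F G]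

lemma adjoin_range_ι :
    Algebra.adjoin F (Set.range (ι F (L := G))) = ⊤ := by
  let A := Algebra.adjoin F (Set.range (ι F (L := G)))
  let ι' : G →ₗ⁅F⁆ A :=
    { toLinearMap := (ι F : G →ₗ⁅F⁆ _).toLinearMap.codRestrict
        A.toSubmodule fun x => Algebra.subset_adjoin ⟨x, rfl⟩
      map_lie' := fun {x y} => Subtype.ext (LieHom.map_lie (ι F) x y) }
  have hid : A.val.comp (UniversalEnvelopingAlgebra.lift F ι') =
      AlgHom.id F (UniversalEnvelopingAlgebra F G) := by
    refine UniversalEnvelopingAlgebra.hom_ext F (LieHom.ext fun x => ?_)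
    change ((UniversalEnvelopingAlgebra.lift F ι' (ι F x) : A) :
      UniversalEnvelopingAlgebra F G) = ι F x
    rw [UniversalEnvelopingAlgebra.lift_ι_apply]
    rfl
  refine top_le_iff.1 fun u _ => ?_
  rw [show u = A.val (UniversalEnvelopingAlgebra.lift F ι' u) from (DFunLike.congr_fun hid u).symm]
  exact Subtype.property _

lemma smul_mem_of_ι_smul_mem {M : Type*} [AddCommGroup M] [Module F M]
    [Module (UniversalEnvelopingAlgebra F G) M] [IsScalarTower F (UniversalEnvelopingAlgebra F G) M]
    {S : Submodule F M} (hS : ∀ x : G, ∀ m ∈ S, ι F x • m ∈ S)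
    (u : UniversalEnvelopingAlgebra F G) : ∀ m ∈ S, u • m ∈ S := by
  have hu : u ∈ Algebra.adjoin F (Set.range (ι F (L := G))) :=
    adjoin_range_ι (F := F) (G := G) ▸ Algebra.mem_top
  induction hu using Algebra.adjoin_induction with
  | mem _ hx => obtain ⟨x, rfl⟩ := hx; exact hS x
  | algebraMap c => exact fun m hm => by simpa only [algebraMap_smul] using S.smul_mem c hm
  | add a b _ _ ha hb => exact fun m hm => by rw [add_smul]; exact S.add_mem (ha m hm) (hb m hm)
  | mul a b _ _ ha hb => exact fun m hm => by rw [mul_smul]; exact ha _ (hb m hm)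

end EnvelopingAlgebra

section InducedModule

variable {F G : Type*} [Field F] [LieRing G] [LieAlgebra F G]
  {V : Type*} [AddCommGroup V] [Module F V] {P : LieSubalgebra F G}
  (ρ : P →ₗ⁅F⁆ Module.End F V)

lemma Ind.mk_eq_smul_incl (u : UniversalEnvelopingAlgebra F G) (y : V) :
    Ind.mk ρ u y = u • Ind.incl ρ y := by
  change _ = u • (indRel ρ).mkQ (1 ⊗ₜ[F] y)
  rw [← map_smul, TensorProduct.smul_tmul', smul_eq_mul, mul_one, Ind.mk]

lemma Ind.ι_smul_incl (x : P) (y : V) : ι F (x : G) • Ind.incl ρ y = Ind.incl ρ (ρ x y) := by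
  rw [← Ind.mk_eq_smul_incl, ← sub_eq_zero]
  change (indRel ρ).mkQ _ - (indRel ρ).mkQ (1 ⊗ₜ[F] ρ x y) = 0
  rw [← map_sub, Submodule.mkQ_apply, Submodule.Quotient.mk_eq_zero]
  exact Submodule.subset_span ⟨1, x, y, by rw [one_mul]⟩

lemma Ind.eq_top_of_ι_smul_mem {S : Submodule F (Ind ρ)}
    (hS : ∀ x : G, ∀ m ∈ S, ι F x • m ∈ S) (hV : ∀ y, Ind.incl ρ y ∈ S) : S = ⊤ := by
  refine Submodule.eq_top_iff'.2 fun m => ?_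
  obtain ⟨t, rfl⟩ := Submodule.mkQ_surjective _ m
  induction t using TensorProduct.induction_on with
  | zero => rw [map_zero]; exact S.zero_mem
  | tmul u y =>
    change Ind.mk ρ u y ∈ S
    rw [Ind.mk_eq_smul_incl]
    exact smul_mem_of_ι_smul_mem hS u _ (hV y)
  | add a b ha hb => rw [map_add]; exact S.add_mem ha hb

variable {N : Type*} [AddCommGroup N] [Module F N] (θ : G →ₗ⁅F⁆ Module.End F N) (f : V →ₗ[F] N)

/-- The map `u ⊗ y ↦ u f(y)` from `U(G) ⊗_F V` to a representation `θ` of `G`. -/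
def tensorLift : UniversalEnvelopingAlgebra F G ⊗[F] V →ₗ[F] N :=
  TensorProduct.lift (LinearMap.lcomp F N f ∘ₗ (UniversalEnvelopingAlgebra.lift F θ).toLinearMap)

lemma tensorLift_smul (u : UniversalEnvelopingAlgebra F G)
    (t : UniversalEnvelopingAlgebra F G ⊗[F] V) :
    tensorLift θ f (u • t) = UniversalEnvelopingAlgebra.lift F θ u (tensorLift θ f t) := by
  induction t using TensorProduct.induction_on with
  | zero => simp only [smul_zero, map_zero]
  | tmul u' y => simp [tensorLift, TensorProduct.smul_tmul']
  | add a b ha hb => simp only [smul_add, map_add, ha, hb]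

variable {ρ θ f}

lemma tensorLift_eq_zero (hf : ∀ (x : P) y, θ x (f y) = f (ρ x y))
    {t : UniversalEnvelopingAlgebra F G ⊗[F] V} (ht : t ∈ indRel ρ) : tensorLift θ f t = 0 := by
  induction ht using Submodule.span_induction with
  | mem t h =>
    obtain ⟨u, x, y, rfl⟩ := h
    simp [tensorLift, hf]
  | zero => exact map_zero _
  | add a b _ _ ha hb => rw [map_add, ha, hb, add_zero]
  | smul u t _ h => rw [tensorLift_smul, h, map_zero]

/-- Frobenius reciprocity: a `P`-equivariant map from `V` to a representation `θ` of `G` extends to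
the induced module. -/
def Ind.lift (hf : ∀ (x : P) y, θ x (f y) = f (ρ x y)) : Ind ρ →ₗ[F] N :=
  ((indRel ρ).restrictScalars F).liftQ (tensorLift θ f) (fun _ ht => tensorLift_eq_zero hf ht) ∘ₗ
    (Submodule.Quotient.restrictScalarsEquiv F (indRel ρ)).symm.toLinearMap

lemma Ind.lift_mk (hf : ∀ (x : P) y, θ x (f y) = f (ρ x y)) (u : UniversalEnvelopingAlgebra F G)
    (y : V) : Ind.lift hf (Ind.mk ρ u y) = UniversalEnvelopingAlgebra.lift F θ u (f y) := rfl

end InducedModule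

section GradedAction

variable {F G Γ M : Type*} [Field F] [LieRing G] [LieAlgebra F G] [AddCommGroup M] [Module F M]
  [Module (UniversalEnvelopingAlgebra F G) M]

lemma ι_smul_mem_iSup [AddCommMonoid Γ] [DecidableEq Γ] {𝒢 : Γ → Submodule F G}
    [GradedLieAlgebra 𝒢] {N : Γ → Submodule F M}
    (hN : ∀ γ δ, ∀ x ∈ 𝒢 γ, ∀ m ∈ N δ, ι F x • m ∈ N (γ + δ)) (x : G) {m : M}
    (hm : m ∈ ⨆ γ, N γ) : ι F x • m ∈ ⨆ γ, N γ := by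
  induction hm using Submodule.iSup_induction' with
  | mem δ m hm =>
    induction x using DirectSum.Decomposition.inductionOn 𝒢 with
    | zero => simp only [map_zero, zero_smul, Submodule.zero_mem]
    | add x x' hx hx' => rw [map_add, add_smul]; exact Submodule.add_mem _ hx hx'
    | homogeneous x => exact Submodule.mem_iSup_of_mem _ (hN _ δ x x.2 m hm)
  | zero => rw [smul_zero]; exact Submodule.zero_mem _
  | add m m' _ _ hm hm' => rw [smul_add]; exact Submodule.add_mem _ hm hm'

end GradedAction

section ShiftAction

variable {F G Γ : Type*} [Field F] [LieRing G] [LieAlgebra F G] [AddCommGroup Γ] [DecidableEq Γ]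
  (𝒢 : Γ → Submodule F G) [GradedLieAlgebra 𝒢] (M : Type*) [AddCommGroup M] [Module F M]
  [Module (UniversalEnvelopingAlgebra F G) M] [IsScalarTower F (UniversalEnvelopingAlgebra F G) M]

/-- The linear map underlying `shiftAction`. -/
def shiftMap : G →ₗ[F] Module.End F (Γ → M) :=
  DirectSum.toModule F Γ (Module.End F (Γ → M)) (fun γ =>
    LinearMap.mk₂ F (fun (x : 𝒢 γ) f δ => ι F (x : G) • f (δ - γ))
      (fun x y f => by ext δ; simp [add_smul])
      (fun c x f => by ext δ; simp [smul_assoc])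
      (fun x f f' => by ext δ; simp)
      (fun c x f => by ext δ; simp [smul_algebra_smul_comm])) ∘ₗ
    (DirectSum.decomposeLinearEquiv 𝒢).toLinearMap

variable {𝒢 M}

lemma shiftMap_apply {γ : Γ} {x : G} (hx : x ∈ 𝒢 γ) (f : Γ → M) (δ : Γ) :
    shiftMap 𝒢 M x f δ = ι F x • f (δ - γ) := by
  rw [shiftMap, LinearMap.comp_apply, LinearEquiv.coe_coe, DirectSum.decomposeLinearEquiv_apply,
    DirectSum.decompose_of_mem 𝒢 hx, ← DirectSum.lof_eq_of F, DirectSum.toModule_lof]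
  rfl

lemma shiftMap_lie (x y : G) :
    shiftMap 𝒢 M ⁅x, y⁆ = ⁅shiftMap 𝒢 M x, shiftMap 𝒢 M y⁆ := by
  induction x using DirectSum.Decomposition.inductionOn 𝒢 with
  | zero => simp only [zero_lie, map_zero]
  | add x x' hx hx' => simp only [add_lie, map_add, hx, hx']
  | @homogeneous γ x =>
    induction y using DirectSum.Decomposition.inductionOn 𝒢 with
    | zero => simp only [lie_zero, map_zero]
    | add y y' hy hy' => simp only [lie_add, map_add, hy, hy']
    | @homogeneous δ y =>
      refine LinearMap.ext fun f => funext fun ε => ?_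
      have hxy : ⁅(x : G), (y : G)⁆ ∈ 𝒢 (γ + δ) :=
        SetLike.GradedBracket.bracket_mem x.2 y.2
      simp only [Ring.lie_def, LinearMap.sub_apply, Module.End.mul_apply, Pi.sub_apply,
        shiftMap_apply hxy, shiftMap_apply x.2, shiftMap_apply y.2, LieHom.map_lie, sub_smul,
        mul_smul, sub_sub, add_comm δ γ]

variable (𝒢 M) in
/-- The action of a `Γ`-graded Lie algebra on the functions `Γ → M` with values in a module `M`
in which a homogeneous element of degree `γ` also translates the argument by `γ`. The map
`M → (Γ → M)`, `m ↦ Pi.single γ m` for `m` of degree `γ`, is equivariant if `M` is graded, and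
conversely such an equivariant map grades `M`. -/
def shiftAction : G →ₗ⁅F⁆ Module.End F (Γ → M) :=
  { shiftMap 𝒢 M with map_lie' := fun {x y} => shiftMap_lie x y }

lemma shiftAction_single {γ : Γ} {x : G} (hx : x ∈ 𝒢 γ) (δ : Γ) (m : M) :
    shiftAction 𝒢 M x (Pi.single δ m) = Pi.single (γ + δ) (ι F x • m) := by
  funext ε
  change shiftMap 𝒢 M x _ ε = _
  rw [shiftMap_apply hx]
  simp only [Pi.single_apply, sub_eq_iff_eq_add', smul_ite, smul_zero]

lemma lift_shiftAction_single {δ : Γ} {u : UniversalEnvelopingAlgebra F G} (hu : IsMonomial 𝒢 δ u)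
    (ε : Γ) (m : M) : UniversalEnvelopingAlgebra.lift F (shiftAction 𝒢 M) u (Pi.single ε m) =
      Pi.single (δ + ε) (u • m) := by
  induction hu with
  | one => simp only [map_one, Module.End.one_apply, zero_add, one_smul]
  | mul hx _ ih =>
    rw [map_mul, Module.End.mul_apply, ih, UniversalEnvelopingAlgebra.lift_ι_apply,
      shiftAction_single hx, mul_smul, add_assoc]

end ShiftAction

section InducedGrading

variable {F G Γ : Type*} [Field F] [LieRing G] [LieAlgebra F G]
  {V : Type*} [AddCommGroup V] [Module F V] (𝒱 : Γ → Submodule F V)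
  {P : LieSubalgebra F G} (ρ : P →ₗ⁅F⁆ Module.End F V)

/-- The family of the homogeneous components of `1 ⊗ y`. -/
def inclParts [DecidableEq Γ] [DirectSum.Decomposition 𝒱] : V →ₗ[F] Γ → Ind ρ :=
  (Ind.incl ρ).compLeft Γ ∘ₗ homogeneousParts 𝒱

variable {𝒱 ρ}

lemma inclParts_of_mem [DecidableEq Γ] [DirectSum.Decomposition 𝒱] {γ : Γ} {y : V}
    (hy : y ∈ 𝒱 γ) : inclParts 𝒱 ρ y = Pi.single γ (Ind.incl ρ y) := by
  funext δ
  simp [inclParts, homogeneousParts_of_mem hy, Pi.apply_single (fun _ => Ind.incl ρ)]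

variable [AddCommGroup Γ] {𝒢 : Γ → Submodule F G}

lemma incl_mem_indComponent {γ : Γ} {y : V} (hy : y ∈ 𝒱 γ) :
    Ind.incl ρ y ∈ indComponent 𝒢 𝒱 ρ γ :=
  Submodule.subset_span ⟨0, γ, 1, y, zero_add γ, .one, hy, rfl⟩

lemma ι_smul_mem_indComponent {γ δ : Γ} {x : G} (hx : x ∈ 𝒢 γ) {m : Ind ρ}
    (hm : m ∈ indComponent 𝒢 𝒱 ρ δ) : ι F x • m ∈ indComponent 𝒢 𝒱 ρ (γ + δ) := by
  have hle : indComponent 𝒢 𝒱 ρ δ ≤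
      (indComponent 𝒢 𝒱 ρ (γ + δ)).comap (Algebra.lsmul F F (Ind ρ) (ι F x)) := by
    refine Submodule.span_le.2 ?_
    rintro _ ⟨δ', ε, u, y, rfl, hu, hy, rfl⟩
    refine Submodule.subset_span ⟨γ + δ', ε, ι F x * u, y, add_assoc _ _ _, .mul hx hu, hy, ?_⟩
    rw [Algebra.lsmul_apply, Ind.mk_eq_smul_incl, Ind.mk_eq_smul_incl, mul_smul]
  exact hle hm

lemma indComponent_le {N : Γ → Submodule F (Ind ρ)}
    (hι : ∀ γ δ, ∀ x ∈ 𝒢 γ, ∀ m ∈ N δ, ι F x • m ∈ N (γ + δ))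
    (hincl : ∀ γ, ∀ y ∈ 𝒱 γ, Ind.incl ρ y ∈ N γ) (γ : Γ) : indComponent 𝒢 𝒱 ρ γ ≤ N γ := by
  refine Submodule.span_le.2 ?_
  rintro _ ⟨δ, ε, u, y, rfl, hu, hy, rfl⟩
  rw [SetLike.mem_coe, Ind.mk_eq_smul_incl]
  induction hu with
  | one => simpa only [zero_add, one_smul] using hincl ε y hy
  | mul hx _ ih => rw [mul_smul, add_assoc]; exact hι _ _ _ hx _ ih

variable [DecidableEq Γ] [GradedLieAlgebra 𝒢]

lemma iSup_indComponent (h𝒱 : ⨆ γ, 𝒱 γ = ⊤) : ⨆ γ, indComponent 𝒢 𝒱 ρ γ = ⊤ := by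
  refine Ind.eq_top_of_ι_smul_mem ρ (fun x m hm => ?_) fun y => ?_
  · exact ι_smul_mem_iSup (fun γ δ x hx m hm => ι_smul_mem_indComponent hx hm) x hm
  · have hle : ⨆ γ, 𝒱 γ ≤ (⨆ γ, indComponent 𝒢 𝒱 ρ γ).comap (Ind.incl ρ) :=
      iSup_le fun γ _ hy => Submodule.mem_iSup_of_mem γ (incl_mem_indComponent hy)
    exact hle (h𝒱 ▸ Submodule.mem_top)

variable [DirectSum.Decomposition 𝒱]

lemma shiftAction_inclParts (hP : ⨆ γ, (𝒢 γ).comap P.toSubmodule.subtype = ⊤)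
    (hρ : ∀ γ δ, ∀ x : P, (x : G) ∈ 𝒢 γ → ∀ y ∈ 𝒱 δ, ρ x y ∈ 𝒱 (γ + δ)) (x : P) (y : V) :
    shiftAction 𝒢 (Ind ρ) x (inclParts 𝒱 ρ y) = inclParts 𝒱 ρ (ρ x y) := by
  induction y using DirectSum.Decomposition.inductionOn 𝒱 with
  | zero => simp only [map_zero]
  | add y y' hy hy' => simp only [map_add, hy, hy']
  | @homogeneous δ y =>
    have hx : x ∈ ⨆ γ, (𝒢 γ).comap P.toSubmodule.subtype := hP ▸ Submodule.mem_top
    induction hx using Submodule.iSup_induction' with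
    | mem γ x hx =>
      have hx : (x : G) ∈ 𝒢 γ := hx
      rw [inclParts_of_mem y.2, shiftAction_single hx, inclParts_of_mem (hρ γ δ x hx y y.2),
        ← Ind.ι_smul_incl]
    | zero => simp
    | add x x' _ _ hx hx' => simp [hx, hx']

theorem isInternal_indComponent (hP : ⨆ γ, (𝒢 γ).comap P.toSubmodule.subtype = ⊤)
    (hρ : ∀ γ δ, ∀ x : P, (x : G) ∈ 𝒢 γ → ∀ y ∈ 𝒱 δ, ρ x y ∈ 𝒱 (γ + δ)) :
    DirectSum.IsInternal (indComponent 𝒢 𝒱 ρ) := by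
  refine isInternal_of_parts (Ind.lift (shiftAction_inclParts hP hρ)) (fun γ => ?_)
    (iSup_indComponent (DirectSum.Decomposition.isInternal 𝒱).submodule_iSup_eq_top)
  intro m hm
  induction hm using Submodule.span_induction with
  | mem m hm =>
    obtain ⟨δ, ε, u, y, rfl, hu, hy, rfl⟩ := hm
    rw [Ind.lift_mk, inclParts_of_mem hy, lift_shiftAction_single hu, Ind.mk_eq_smul_incl]
  | zero => rw [map_zero, Pi.single_zero]
  | add a b _ _ ha hb => rw [map_add, Pi.single_add, ha, hb]
  | smul c a _ ha => rw [map_smul, Pi.single_smul, ha]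

end InducedGrading

section Straightening

variable {R A M I Δ : Type*} [CommRing R] [Ring A] [AddCommGroup M] [Module R M] [Module A M]
  [AddCommMonoid Δ] {a : I → A} {wt : I → Δ} {C : Set I} {W : Δ → Submodule R M}

variable (a wt C W) in
/-- The span of the elements `a_{i_1} ⋯ a_{i_s} w` of weight `d` such that `i_1, …, i_s` lie in a
set `C` of creation operators and `w ∈ W e` is a generator of weight `e`. -/
def normalForms (d : Δ) : Submodule R M :=
  Submodule.span R {m | ∃ (l : List I) (e : Δ) (w : M), (∀ i ∈ l, i ∈ C) ∧ w ∈ W e ∧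
    (l.map wt).sum + e = d ∧ m = (l.map a).prod • w}

lemma le_normalForms (d : Δ) : W d ≤ normalForms a wt C W d := fun w hw =>
  Submodule.subset_span ⟨[], d, w, by simp, hw, by simp, by simp⟩

lemma word_smul_mem_of_smul_mem {N : Δ → Submodule R M}
    (hN : ∀ i d, ∀ m ∈ N d, a i • m ∈ N (wt i + d)) (l : List I) {d : Δ} {m : M} (hm : m ∈ N d) :
    (l.map a).prod • m ∈ N ((l.map wt).sum + d) := by
  induction l with
  | nil => simpa using hm
  | cons i l ih => simpa [mul_smul, add_assoc] using hN i _ _ ih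

lemma normalForms_le {N : Δ → Submodule R M} (hN : ∀ i d, ∀ m ∈ N d, a i • m ∈ N (wt i + d))
    (hW : ∀ e, W e ≤ N e) (d : Δ) : normalForms a wt C W d ≤ N d := by
  refine Submodule.span_le.2 ?_
  rintro _ ⟨l, e, w, -, hw, rfl, rfl⟩
  exact word_smul_mem_of_smul_mem hN l (hW e hw)

variable {φ : Δ →+ ℤ}

lemma apply_sum_nonpos (hC : ∀ i ∈ C, φ (wt i) ≤ 0) {l : List I} (hl : ∀ i ∈ l, i ∈ C) :
    φ (l.map wt).sum ≤ 0 := by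
  induction l with
  | nil => simp
  | cons i l ih =>
    obtain ⟨hi, hl⟩ := List.forall_mem_cons.1 hl
    simpa using add_nonpos (hC i hi) (ih hl)

lemma normalForms_le_of_nonneg (hC : ∀ i ∈ C, φ (wt i) < 0) (hW : ∀ e, 0 < φ e → W e = ⊥) {d : Δ}
    (hd : 0 ≤ φ d) : normalForms a wt C W d ≤ W d := by
  refine Submodule.span_le.2 ?_
  rintro _ ⟨l, e, w, hl, hw, rfl, rfl⟩
  cases l with
  | nil => simpa using hw
  | cons i l =>
    obtain ⟨hi, hl⟩ := List.forall_mem_cons.1 hl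
    have hsum := apply_sum_nonpos (fun i hi => (hC i hi).le) hl
    simp only [List.map_cons, List.sum_cons, map_add] at hd
    obtain rfl : w = 0 := by simpa [hW e (by linarith [hC i hi])] using hw
    simp

lemma normalForms_eq_bot_of_nonneg (hC : ∀ i ∈ C, φ (wt i) ≤ 0) (hW : ∀ e, 0 ≤ φ e → W e = ⊥)
    {d : Δ} (hd : 0 ≤ φ d) : normalForms a wt C W d = ⊥ := by
  refine eq_bot_iff.2 (Submodule.span_le.2 ?_)
  rintro _ ⟨l, e, w, hl, hw, rfl, rfl⟩
  have hsum := apply_sum_nonpos hC hl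
  rw [map_add] at hd
  obtain rfl : w = 0 := by simpa [hW e (by linarith)] using hw
  simp

variable [SMulCommClass A R M]

lemma smul_mem_normalForms_of_mem {i : I} (hi : i ∈ C) {d : Δ} {m : M}
    (hm : m ∈ normalForms a wt C W d) : a i • m ∈ normalForms a wt C W (wt i + d) := by
  have hle : normalForms a wt C W d ≤
      (normalForms a wt C W (wt i + d)).comap (DistribSMul.toLinearMap R M (a i)) := by
    refine Submodule.span_le.2 ?_
    rintro _ ⟨l, e, w, hl, hw, rfl, rfl⟩
    exact Submodule.subset_span ⟨i :: l, e, w, List.forall_mem_cons.2 ⟨hi, hl⟩, hw,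
      by simp [add_assoc], by simp [DistribSMul.toLinearMap_apply, mul_smul]⟩
  exact hle hm

variable [Module R A] [IsScalarTower R A M]

lemma smul_word_smul_mem_normalForms
    (hcomm : ∀ i j, a i * a j - a j * a i ∈ Submodule.span R (a '' {k | wt k = wt i + wt j}))
    (hW : ∀ i ∉ C, ∀ e, ∀ w ∈ W e, a i • w ∈ W (wt i + e)) {e : Δ} {w : M} (hw : w ∈ W e)
    {l : List I} (hl : ∀ i ∈ l, i ∈ C) (i : I) :
    a i • (l.map a).prod • w ∈ normalForms a wt C W (wt i + ((l.map wt).sum + e)) := by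
  induction l generalizing i with
  | nil =>
    by_cases hi : i ∈ C
    · exact smul_mem_normalForms_of_mem hi (by simpa using le_normalForms e hw)
    · simpa using le_normalForms _ (hW i hi e w hw)
  | cons j l ih =>
    obtain ⟨hj, hl⟩ := List.forall_mem_cons.1 hl
    have hcommutator : (a i * a j - a j * a i) • (l.map a).prod • w ∈
        normalForms a wt C W (wt i + wt j + ((l.map wt).sum + e)) := by
      have hle : Submodule.span R (a '' {k | wt k = wt i + wt j}) ≤
          (normalForms a wt C W (wt i + wt j + ((l.map wt).sum + e))).comap
            ((LinearMap.toSpanSingleton A M ((l.map a).prod • w)).restrictScalars R) := by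
        refine Submodule.span_le.2 ?_
        rintro _ ⟨k, hk, rfl⟩
        exact hk ▸ ih hl k
      exact hle (hcomm i j)
    have hswapped := smul_mem_normalForms_of_mem hj (ih hl i)
    have hsplit : a i • ((j :: l).map a).prod • w =
        (a i * a j - a j * a i) • (l.map a).prod • w + a j • a i • (l.map a).prod • w := by
      rw [sub_smul, mul_smul, mul_smul, sub_add_cancel, List.map_cons, List.prod_cons, mul_smul]
    rw [hsplit, List.map_cons, List.sum_cons]
    rw [add_left_comm] at hswapped
    rw [add_assoc] at hcommutator ⊢
    exact add_mem hcommutator hswapped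

/-- Straightening, as in the Poincaré-Birkhoff-Witt theorem: an operator is moved to the right past
the creation operators, at the price of commutators, which are shorter. -/
lemma smul_mem_normalForms
    (hcomm : ∀ i j, a i * a j - a j * a i ∈ Submodule.span R (a '' {k | wt k = wt i + wt j}))
    (hW : ∀ i ∉ C, ∀ e, ∀ w ∈ W e, a i • w ∈ W (wt i + e)) (i : I) {d : Δ} {m : M}
    (hm : m ∈ normalForms a wt C W d) : a i • m ∈ normalForms a wt C W (wt i + d) := by
  have hle : normalForms a wt C W d ≤
      (normalForms a wt C W (wt i + d)).comap (DistribSMul.toLinearMap R M (a i)) := by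
    refine Submodule.span_le.2 ?_
    rintro _ ⟨l, e, w, hl, hw, rfl, rfl⟩
    exact smul_word_smul_mem_normalForms hcomm hW hw hl i
  exact hle hm

end Straightening

section Extragraded

variable {F G : Type*} [Field F] [LieRing G] [LieAlgebra F G] {n : ℕ}
  {𝒜 : (Fin n → ℤ) → Submodule F G} [GradedLieAlgebra 𝒜]
  {ℬ : ℤ → Submodule F G} [GradedLieAlgebra ℬ]
  {K : Type*} {g : K → (Fin n → ℤ) → G} {deg : K → ℤ}

lemma IsExtragraded.mem_bigrading (hG : IsExtragraded 𝒜 ℬ g deg) (p : K × (Fin n → ℤ)) :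
    Function.uncurry g p ∈ bigrading 𝒜 ℬ (Prod.map deg id p) :=
  ⟨hG.mem p.1 p.2, hG.isExpPolynomialLie.mem p.1 p.2⟩

lemma IsExtragraded.span_range_eq_top (hG : IsExtragraded 𝒜 ℬ g deg) :
    Submodule.span F (Set.range (Function.uncurry g)) = ⊤ := by
  rw [← hG.isExpPolynomialLie.span_eq_top]
  congr 1
  ext x
  simp [eq_comm]

lemma IsExtragraded.isInternal_bigrading (hG : IsExtragraded 𝒜 ℬ g deg) :
    DirectSum.IsInternal (bigrading 𝒜 ℬ) :=
  isInternal_inf (iSup_eq_top_of_span_eq_top hG.mem_bigrading hG.span_range_eq_top)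

/-- The `ℤ^{n+1}`-grading of an extragraded Lie algebra. -/
abbrev IsExtragraded.gradedLieAlgebra (hG : IsExtragraded 𝒜 ℬ g deg) :
    GradedLieAlgebra (bigrading 𝒜 ℬ) :=
  { hG.isInternal_bigrading.chooseDecomposition with
    bracket_mem := fun _ _ _ _ hx hy =>
      ⟨SetLike.GradedBracket.bracket_mem hx.1 hy.1, SetLike.GradedBracket.bracket_mem hx.2 hy.2⟩ }

lemma IsExtragraded.bigrading_le_span (hG : IsExtragraded 𝒜 ℬ g deg) (γ : ℤ × (Fin n → ℤ)) :
    bigrading 𝒜 ℬ γ ≤ Submodule.span F (Function.uncurry g '' {p | Prod.map deg id p = γ}) := by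
  let := hG.gradedLieAlgebra
  exact le_span_of_span_eq_top hG.mem_bigrading hG.span_range_eq_top γ

lemma IsExtragraded.ι_smul_mem (hG : IsExtragraded 𝒜 ℬ g deg) {M : Type*} [AddCommGroup M]
    [Module F M] [Module (UniversalEnvelopingAlgebra F G) M]
    [IsScalarTower F (UniversalEnvelopingAlgebra F G) M]
    {N : ℤ × (Fin n → ℤ) → Submodule F M}
    (hN : ∀ p γ, ∀ m ∈ N γ, ι F (Function.uncurry g p) • m ∈ N (Prod.map deg id p + γ))
    (γ δ : ℤ × (Fin n → ℤ)) (x : G) (hx : x ∈ bigrading 𝒜 ℬ γ) (m : M) (hm : m ∈ N δ) :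
    ι F x • m ∈ N (γ + δ) := by
  replace hx := hG.bigrading_le_span γ hx
  induction hx using Submodule.span_induction with
  | mem _ h => obtain ⟨p, rfl, rfl⟩ := h; exact hN p δ m hm
  | zero => simp only [map_zero, zero_smul, Submodule.zero_mem]
  | add x y _ _ hx hy => rw [map_add, add_smul]; exact add_mem hx hy
  | smul c x _ hx => rw [map_smul, smul_assoc]; exact Submodule.smul_mem _ c hx

lemma IsExtragraded.commutator_mem_span (hG : IsExtragraded 𝒜 ℬ g deg)
    (p q : K × (Fin n → ℤ)) :
    ι F (Function.uncurry g p) * ι F (Function.uncurry g q) -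
        ι F (Function.uncurry g q) * ι F (Function.uncurry g p) ∈
      Submodule.span F ((fun r => ι F (Function.uncurry g r)) ''
        {r | Prod.map deg id r = Prod.map deg id p + Prod.map deg id q}) := by
  let := hG.gradedLieAlgebra
  have hbracket := hG.bigrading_le_span _ <|
    SetLike.GradedBracket.bracket_mem (hG.mem_bigrading p) (hG.mem_bigrading q)
  have h := Submodule.mem_map_of_mem (f := (ι F : G →ₗ⁅F⁆ _).toLinearMap) hbracket
  rw [Submodule.map_span, Set.image_image] at h
  rwa [← Ring.lie_def, ← LieHom.map_lie]

lemma IsExtragraded.exists_homogeneous_structure (hG : IsExtragraded 𝒜 ℬ g deg) (k r : K) :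
    ∃ f : K →₀ ExpPoly₂ F n, (∀ s ∈ f.support, deg s = deg k + deg r) ∧
      ∀ α β, ⁅g k α, g r β⁆ = f.sum fun s c => c.eval α β • g s (α + β) := by
  classical
  obtain ⟨f, hf⟩ := hG.isExpPolynomialLie.exists_structure
  refine ⟨(f k r).filter fun s => deg s = deg k + deg r, by simp, fun α β => ?_⟩
  have hpart := congrFun (homogeneousParts_of_mem
    (SetLike.GradedBracket.bracket_mem (hG.mem k α) (hG.mem r β))) (deg k + deg r)
  rw [Pi.single_eq_same, hf] at hpart
  rw [hf, ← hpart, Finsupp.sum, map_sum, Finset.sum_apply, Finsupp.sum_filter_index,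
    Finsupp.support_filter, Finset.sum_filter]
  refine Finset.sum_congr rfl fun s _ => ?_
  rw [map_smul, homogeneousParts_of_mem (hG.mem s _), Pi.smul_apply, Pi.single_apply, smul_ite,
    smul_zero]
  simp only [eq_comm]

variable {V : Type*} [AddCommGroup V] [Module F V]
  [LieRingModule (zeroPart ℬ) V] [LieModule F (zeroPart ℬ) V]
  {J : Type*} {v : Module.Basis (J × (Fin n → ℤ)) F V}

lemma bigradingModule_eq_span (γ : ℤ × (Fin n → ℤ)) :
    bigradingModule (moduleComponent v) γ = Submodule.span F (v '' {p | (0, p.2) = γ}) := by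
  obtain ⟨i, α⟩ := γ
  obtain rfl | hi := eq_or_ne i 0
  · simp only [bigradingModule, if_true, moduleComponent]
    congr 1
    ext y
    simp [eq_comm]
  · simp [bigradingModule, hi, hi.symm]

lemma basis_mem_bigradingModule (j : J) (β : Fin n → ℤ) :
    v (j, β) ∈ bigradingModule (moduleComponent v) (0, β) :=
  bigradingModule_eq_span (v := v) (0, β) ▸ Submodule.subset_span ⟨(j, β), rfl, rfl⟩

lemma isInternal_bigradingModule : DirectSum.IsInternal (bigradingModule (moduleComponent v)) := by
  simpa only [funext bigradingModule_eq_span] using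
    isInternal_span_basis v fun p : J × (Fin n → ℤ) => ((0 : ℤ), p.2)

lemma zeroComponent_eq_zeroSpanningSet (hg : ∀ k α, g k α ∈ ℬ (deg k)) {k : K} (hk : deg k = 0)
    (α : Fin n → ℤ) : zeroComponent ℬ (g k α) = zeroSpanningSet ℬ hg ⟨k, hk⟩ α :=
  Subtype.ext (zeroComponent_of_mem ℬ (hk ▸ hg k α))

lemma IsExtragraded.zeroComponent_lie_mem (hG : IsExtragraded 𝒜 ℬ g deg)
    (hV : IsExpPolynomialModule (zeroSpanningSet ℬ hG.mem) v) (γ δ : ℤ × (Fin n → ℤ))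
    (x : G) (hx : x ∈ bigrading 𝒜 ℬ γ) (y : V) (hy : y ∈ bigradingModule (moduleComponent v) δ) :
    ⁅zeroComponent ℬ x, y⁆ ∈ bigradingModule (moduleComponent v) (γ + δ) := by
  by_cases hγ : γ.1 = 0
  swap
  · rw [zeroComponent_of_mem_ne ℬ hx.1 hγ, zero_lie]
    exact Submodule.zero_mem _
  replace hx := hG.bigrading_le_span γ hx
  rw [bigradingModule_eq_span] at hy
  induction hx using Submodule.span_induction with
  | mem _ h =>
    obtain ⟨⟨k, α⟩, rfl, rfl⟩ := h
    induction hy using Submodule.span_induction with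
    | mem _ h =>
      obtain ⟨⟨j, β⟩, rfl, rfl⟩ := h
      obtain ⟨h, hh⟩ := hV
      change ⁅zeroComponent ℬ (g k α), _⁆ ∈ bigradingModule _ (deg k + 0, α + β)
      rw [zeroComponent_eq_zeroSpanningSet hG.mem hγ, hh, show deg k = 0 from hγ, add_zero]
      exact Submodule.sum_mem _ fun s _ =>
        Submodule.smul_mem _ _ (basis_mem_bigradingModule s (α + β))
    | zero => rw [lie_zero]; exact Submodule.zero_mem _
    | add y z _ _ hy hz => rw [lie_add]; exact add_mem hy hz
    | smul c y _ hy => rw [lie_smul]; exact Submodule.smul_mem _ c hy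
  | zero => rw [map_zero, zero_lie]; exact Submodule.zero_mem _
  | add x x' _ _ hx hx' => rw [map_add, add_lie]; exact add_mem hx hx'
  | smul c x _ hx => rw [map_smul, smul_lie]; exact Submodule.smul_mem _ c hx

lemma le_nonnegPart {i : ℤ} (hi : 0 ≤ i) : ℬ i ≤ (nonnegPart ℬ).toSubmodule := by
  obtain rfl | hi := hi.eq_or_lt
  · exact le_sup_left
  · exact le_sup_of_le_right (le_iSup (fun i : {i : ℤ // 1 ≤ i} => ℬ i) ⟨i, hi⟩)

lemma IsExtragraded.iSup_comap_nonnegPart (hG : IsExtragraded 𝒜 ℬ g deg) :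
    ⨆ γ, (bigrading 𝒜 ℬ γ).comap (nonnegPart ℬ).toSubmodule.subtype = ⊤ := by
  set S := ⨆ γ, (bigrading 𝒜 ℬ γ).comap (nonnegPart ℬ).toSubmodule.subtype
  have hle : ∀ i, 0 ≤ i → ℬ i ≤ S.map (nonnegPart ℬ).toSubmodule.subtype := fun i hi => by
    rw [← hG.span_eq i, Submodule.span_le]
    rintro _ ⟨k, α, rfl, rfl⟩
    exact ⟨⟨g k α, le_nonnegPart hi (hG.mem k α)⟩,
      Submodule.mem_iSup_of_mem (deg k, α) (hG.mem_bigrading (k, α)), rfl⟩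
  have hspan : (nonnegPart ℬ).toSubmodule ≤ S.map (nonnegPart ℬ).toSubmodule.subtype :=
    sup_le (hle 0 le_rfl) (iSup_le fun i => hle i (by have := i.2; omega))
  refine Submodule.eq_top_iff'.2 fun x => ?_
  obtain ⟨x', hx', h⟩ := hspan x.2
  rwa [← Subtype.ext h]

theorem IsExtragraded.isInternal_component (hG : IsExtragraded 𝒜 ℬ g deg)
    (hV : IsExpPolynomialModule (zeroSpanningSet ℬ hG.mem) v) :
    DirectSum.IsInternal (MTilde.component 𝒜 ℬ (moduleComponent v)) := by
  let := hG.gradedLieAlgebra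
  let := (isInternal_bigradingModule (v := v)).chooseDecomposition
  exact isInternal_indComponent hG.iSup_comap_nonnegPart
    fun γ δ x => hG.zeroComponent_lie_mem hV γ δ x

lemma ι_smul_incl_inflate {i : ℤ} (hi : 0 ≤ i) {x : G} (hx : x ∈ ℬ i) (y : V) :
    ι F x • Ind.incl (inflate ℬ V) y = Ind.incl (inflate ℬ V) ⁅zeroComponent ℬ x, y⁆ :=
  Ind.ι_smul_incl (inflate ℬ V) ⟨x, le_nonnegPart hi hx⟩ y

lemma IsExtragraded.component_le_normalForms (hG : IsExtragraded 𝒜 ℬ g deg)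
    (hV : IsExpPolynomialModule (zeroSpanningSet ℬ hG.mem) v) (γ : ℤ × (Fin n → ℤ)) :
    MTilde.component 𝒜 ℬ (moduleComponent v) γ ≤
      normalForms (fun p => ι F (Function.uncurry g p)) (Prod.map deg id) {p | deg p.1 < 0}
        (fun δ => (bigradingModule (moduleComponent v) δ).map (Ind.incl (inflate ℬ V))) γ := by
  refine indComponent_le (hG.ι_smul_mem fun p γ m hm => ?_)
    (fun γ y hy => le_normalForms γ (Submodule.mem_map_of_mem hy)) γ
  refine smul_mem_normalForms hG.commutator_mem_span (fun p hp δ => ?_) p hm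
  rintro _ ⟨y, hy, rfl⟩
  rw [ι_smul_incl_inflate (not_lt.1 hp) (hG.mem_bigrading p).1]
  exact Submodule.mem_map_of_mem (hG.zeroComponent_lie_mem hV _ _ _ (hG.mem_bigrading p) y hy)

lemma IsExtragraded.component_le_map_incl (hG : IsExtragraded 𝒜 ℬ g deg)
    (hV : IsExpPolynomialModule (zeroSpanningSet ℬ hG.mem) v) {γ : ℤ × (Fin n → ℤ)}
    (hγ : 0 ≤ γ.1) : MTilde.component 𝒜 ℬ (moduleComponent v) γ ≤
      (bigradingModule (moduleComponent v) γ).map (Ind.incl (inflate ℬ V)) := by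
  refine (hG.component_le_normalForms hV γ).trans ?_
  refine normalForms_le_of_nonneg (φ := AddMonoidHom.fst ℤ (Fin n → ℤ)) ?_ (fun δ hδ => ?_) hγ
  · exact fun _ hp => hp
  have hδ : δ.1 ≠ 0 := ne_of_gt hδ
  simp only [bigradingModule, hδ, if_false, Submodule.map_bot]

lemma IsExtragraded.component_eq_bot (hG : IsExtragraded 𝒜 ℬ g deg)
    (hV : IsExpPolynomialModule (zeroSpanningSet ℬ hG.mem) v) {γ : ℤ × (Fin n → ℤ)}
    (hγ : 0 < γ.1) : MTilde.component 𝒜 ℬ (moduleComponent v) γ = ⊥ := by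
  refine eq_bot_iff.2 ((hG.component_le_map_incl hV hγ.le).trans ?_)
  simp only [bigradingModule, hγ.ne', if_false, Submodule.map_bot, le_refl]

end Extragraded

section Radical

variable {F G : Type*} [Field F] [LieRing G] [LieAlgebra F G] {n : ℕ}
  {𝒜 : (Fin n → ℤ) → Submodule F G} [GradedLieAlgebra 𝒜]
  {ℬ : ℤ → Submodule F G} [GradedLieAlgebra ℬ]
  {K : Type*} {g : K → (Fin n → ℤ) → G} {deg : K → ℤ}
  {V : Type*} [AddCommGroup V] [Module F V]
  [LieRingModule (zeroPart ℬ) V] [LieModule F (zeroPart ℬ) V]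
  {J : Type*} {v : Module.Basis (J × (Fin n → ℤ)) F V}

lemma IsExtragraded.range_incl_eq_biSup_component (hG : IsExtragraded 𝒜 ℬ g deg)
    (hV : IsExpPolynomialModule (zeroSpanningSet ℬ hG.mem) v) :
    LinearMap.range (Ind.incl (inflate ℬ V)) =
      ⨆ γ ∈ {γ : ℤ × (Fin n → ℤ) | γ.1 = 0}, MTilde.component 𝒜 ℬ (moduleComponent v) γ := by
  apply le_antisymm
  · rw [LinearMap.range_eq_map, ← (isInternal_bigradingModule (v := v)).submodule_iSup_eq_top,
      Submodule.map_iSup]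
    refine iSup_le fun γ => Submodule.map_le_iff_le_comap.2 fun y hy => ?_
    by_cases hγ : γ.1 = 0
    · exact Submodule.mem_iSup_of_mem γ (Submodule.mem_iSup_of_mem hγ (incl_mem_indComponent hy))
    · obtain rfl : y = 0 := by simpa [bigradingModule, hγ] using hy
      exact Submodule.zero_mem _
  · exact iSup₂_le fun γ hγ => (hG.component_le_map_incl hV hγ.ge).trans LinearMap.map_le_range

lemma IsExtragraded.isGradedAvoiding_iff (hG : IsExtragraded 𝒜 ℬ g deg)
    (hV : IsExpPolynomialModule (zeroSpanningSet ℬ hG.mem) v)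
    {N : Submodule (UniversalEnvelopingAlgebra F G) (MTilde ℬ V)} :
    IsGradedAvoiding 𝒜 ℬ (moduleComponent v) N ↔
      IsGradedSubmodule (MTilde.component 𝒜 ℬ (moduleComponent v)) N ∧
        N.restrictScalars F ≤ ⨆ γ ∈ {γ : ℤ × (Fin n → ℤ) | γ.1 = 0}ᶜ,
          MTilde.component 𝒜 ℬ (moduleComponent v) γ := by
  refine and_congr_right fun hN => ?_
  rw [hG.range_incl_eq_biSup_component hV]
  exact inf_biSup_eq_bot_iff_of_isInternal (hG.isInternal_component hV) hN _

theorem IsExtragraded.isGreatest_rad (hG : IsExtragraded 𝒜 ℬ g deg)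
    (hV : IsExpPolynomialModule (zeroSpanningSet ℬ hG.mem) v) :
    IsGreatest {N | IsGradedAvoiding 𝒜 ℬ (moduleComponent v) N}
      (MTilde.rad 𝒜 ℬ (moduleComponent v)) := by
  refine ⟨(hG.isGradedAvoiding_iff hV).2 ⟨?_, ?_⟩, fun N hN => le_sSup hN⟩
  · rw [IsGradedSubmodule, MTilde.rad, Submodule.restrictScalars_sSup]
    refine sSup_le ?_
    rintro _ ⟨N, hN, rfl⟩
    exact hN.1.trans (iSup_mono fun γ => inf_le_inf_right _ (le_sSup ⟨N, hN, rfl⟩))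
  · rw [MTilde.rad, Submodule.restrictScalars_sSup]
    refine sSup_le ?_
    rintro _ ⟨N, hN, rfl⟩
    exact ((hG.isGradedAvoiding_iff hV).1 hN).2

theorem IsExtragraded.isInternal_mquot_component (hG : IsExtragraded 𝒜 ℬ g deg)
    (hV : IsExpPolynomialModule (zeroSpanningSet ℬ hG.mem) v) :
    DirectSum.IsInternal (MQuot.component 𝒜 ℬ (moduleComponent v)) := by
  have hker : LinearMap.ker ((MTilde.rad 𝒜 ℬ (moduleComponent v)).mkQ.restrictScalars F) =
      (MTilde.rad 𝒜 ℬ (moduleComponent v)).restrictScalars F := by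
    rw [LinearMap.ker_restrictScalars, Submodule.ker_mkQ]
  have hsurj : Function.Surjective
      ((MTilde.rad 𝒜 ℬ (moduleComponent v)).mkQ.restrictScalars F) := by
    rw [LinearMap.coe_restrictScalars]
    exact Submodule.mkQ_surjective _
  refine isInternal_map_of_ker_le (hG.isInternal_component hV) hsurj ?_
  rw [hker]
  exact (hG.isGreatest_rad hV).1.1

lemma IsExtragraded.le_rad (hG : IsExtragraded 𝒜 ℬ g deg)
    (hV : IsExpPolynomialModule (zeroSpanningSet ℬ hG.mem) v)
    {N : ℤ × (Fin n → ℤ) → Submodule F (MTilde ℬ V)}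
    (hN : ∀ p γ, ∀ m ∈ N γ, ι F (Function.uncurry g p) • m ∈ N (Prod.map deg id p + γ))
    (hle : ∀ γ, N γ ≤ MTilde.component 𝒜 ℬ (moduleComponent v) γ)
    (hzero : ∀ γ : ℤ × (Fin n → ℤ), γ.1 = 0 → N γ = ⊥) (γ : ℤ × (Fin n → ℤ)) :
    N γ ≤ (MTilde.rad 𝒜 ℬ (moduleComponent v)).restrictScalars F := by
  let := hG.gradedLieAlgebra
  let T : Submodule (UniversalEnvelopingAlgebra F G) (MTilde ℬ V) :=
    { (⨆ γ, N γ).toAddSubmonoid with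
      smul_mem' := fun u m hm => smul_mem_of_ι_smul_mem
        (fun x _ hm => ι_smul_mem_iSup (hG.ι_smul_mem hN) x hm) u m hm }
  have hT : T.restrictScalars F = ⨆ γ, N γ := rfl
  have havoid : IsGradedAvoiding 𝒜 ℬ (moduleComponent v) T := by
    refine (hG.isGradedAvoiding_iff hV).2 ⟨?_, ?_⟩
    · rw [IsGradedSubmodule, hT]
      exact iSup_mono fun γ => le_inf (le_iSup N γ) (hle γ)
    · rw [hT]
      refine iSup_le fun γ => ?_
      by_cases hγ : γ.1 = 0
      · exact (hzero γ hγ).trans_le bot_le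
      · exact (hle γ).trans (le_iSup₂ (f := fun γ _ => MTilde.component 𝒜 ℬ (moduleComponent v) γ)
          γ hγ)
  exact fun m hm => le_sSup (α := Submodule _ _) havoid
    (Submodule.mem_iSup_of_mem γ hm : m ∈ ⨆ γ, N γ)

/-- By straightening, the `U(G)`-submodule generated by `P` is obtained from `P` by operators of
degree at most zero, which cannot reach degree zero from below. -/
lemma IsExtragraded.le_rad_of_raising (hG : IsExtragraded 𝒜 ℬ g deg)
    (hV : IsExpPolynomialModule (zeroSpanningSet ℬ hG.mem) v)
    {P : ℤ × (Fin n → ℤ) → Submodule F (MTilde ℬ V)}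
    (hP : ∀ p γ, 0 < deg p.1 → ∀ m ∈ P γ,
      ι F (Function.uncurry g p) • m ∈ P (Prod.map deg id p + γ))
    (hle : ∀ γ, P γ ≤ MTilde.component 𝒜 ℬ (moduleComponent v) γ)
    (hzero : ∀ γ : ℤ × (Fin n → ℤ), γ.1 = 0 → P γ = ⊥) (γ : ℤ × (Fin n → ℤ)) :
    P γ ≤ (MTilde.rad 𝒜 ℬ (moduleComponent v)).restrictScalars F := by
  have hnonneg : ∀ δ : ℤ × (Fin n → ℤ), 0 ≤ δ.1 → P δ = ⊥ := fun δ hδ =>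
    hδ.eq_or_lt.elim (fun h => hzero δ h.symm)
      fun h => eq_bot_iff.2 ((hle δ).trans (hG.component_eq_bot hV h).le)
  let N := normalForms (fun p => ι F (Function.uncurry g p)) (Prod.map deg id) {p | deg p.1 ≤ 0} P
  have hN : ∀ p δ, ∀ m ∈ N δ, ι F (Function.uncurry g p) • m ∈ N (Prod.map deg id p + δ) :=
    fun p _ _ hm => smul_mem_normalForms hG.commutator_mem_span
      (fun q hq δ => hP q δ (not_le.1 hq)) p hm
  have hN_zero : ∀ δ : ℤ × (Fin n → ℤ), δ.1 = 0 → N δ = ⊥ := fun δ hδ => by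
    refine normalForms_eq_bot_of_nonneg (φ := AddMonoidHom.fst ℤ (Fin n → ℤ)) ?_ hnonneg hδ.ge
    exact fun _ hp => hp
  have hN_le : ∀ δ, N δ ≤ MTilde.component 𝒜 ℬ (moduleComponent v) δ :=
    normalForms_le (fun p _ _ hm => ι_smul_mem_indComponent (hG.mem_bigrading p) hm) hle
  exact (le_normalForms γ).trans (hG.le_rad hV hN hN_le hN_zero γ)

lemma IsExtragraded.mem_rad_of_word_smul_eq_zero (hG : IsExtragraded 𝒜 ℬ g deg)
    (hV : IsExpPolynomialModule (zeroSpanningSet ℬ hG.mem) v) {γ : ℤ × (Fin n → ℤ)}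
    {w : MTilde ℬ V} (hw : w ∈ MTilde.component 𝒜 ℬ (moduleComponent v) γ)
    (hzero : ∀ l : List (K × (Fin n → ℤ)), (∀ p ∈ l, 0 < deg p.1) →
      (l.map (Prod.map deg id)).sum.1 + γ.1 = 0 →
      (l.map fun p => ι F (Function.uncurry g p)).prod • w = 0) :
    w ∈ MTilde.rad 𝒜 ℬ (moduleComponent v) := by
  let W : ℤ × (Fin n → ℤ) → Submodule F (MTilde ℬ V) := fun δ =>
    Submodule.span F {m | δ = γ ∧ m = w}
  have hW : ∀ δ, W δ ≤ MTilde.component 𝒜 ℬ (moduleComponent v) δ := fun δ =>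
    Submodule.span_le.2 fun m hm => by rw [hm.1, hm.2]; exact hw
  let P := normalForms (fun p => ι F (Function.uncurry g p)) (Prod.map deg id) {p | 0 < deg p.1} W
  have hP : ∀ p δ, 0 < deg p.1 → ∀ m ∈ P δ,
      ι F (Function.uncurry g p) • m ∈ P (Prod.map deg id p + δ) :=
    fun p δ hp m hm => smul_mem_normalForms_of_mem
      (a := fun p => ι F (Function.uncurry g p)) (C := {p | 0 < deg p.1}) hp hm
  have hP_le : ∀ δ, P δ ≤ MTilde.component 𝒜 ℬ (moduleComponent v) δ :=
    normalForms_le (fun p _ _ hm => ι_smul_mem_indComponent (hG.mem_bigrading p) hm) hW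
  have hw : w ∈ P γ := le_normalForms γ (Submodule.subset_span ⟨rfl, rfl⟩)
  suffices hP_zero : ∀ δ : ℤ × (Fin n → ℤ), δ.1 = 0 → P δ = ⊥ from
    hG.le_rad_of_raising hV hP hP_le hP_zero γ hw
  intro δ hδ
  refine eq_bot_iff.2 (Submodule.span_le.2 ?_)
  rintro _ ⟨l, e, m, hl, hm, rfl, rfl⟩
  induction hm using Submodule.span_induction with
  | mem m hm =>
    obtain ⟨rfl, rfl⟩ := hm
    exact hzero l hl hδ
  | zero => rw [smul_zero]; exact Submodule.zero_mem _
  | add x y _ _ hx hy => rw [smul_add]; exact add_mem hx hy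
  | smul c x _ hx => rw [smul_comm _ c x]; exact Submodule.smul_mem _ c hx

end Radical

section FiniteRank

variable (F : Type*) [Field F] {Y Z M : Type*} [AddCommGroup M] [Module F M]

/-- A function `f` of two variables is of finite rank if the functions `f(y, ·)` span a
finite-dimensional space, equivalently if `f(y, z)` is a finite sum of products `c(y) u(z)`. -/
def HasFiniteRank (f : Y × Z → M) : Prop :=
  ∃ S : Submodule F (Z → M), S.FG ∧ ∀ y, (fun z => f (y, z)) ∈ S

variable {F}

lemma HasFiniteRank.of_fst (c : Y → F) : HasFiniteRank F fun x : Y × Z => c x.1 :=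
  ⟨Submodule.span F {1}, Submodule.fg_span_singleton _, fun y =>
    Submodule.mem_span_singleton.2 ⟨c y, funext fun _ => mul_one _⟩⟩

lemma HasFiniteRank.of_snd (u : Z → M) : HasFiniteRank F fun x : Y × Z => u x.2 :=
  ⟨Submodule.span F {u}, Submodule.fg_span_singleton _, fun _ =>
    Submodule.mem_span_singleton_self u⟩

lemma HasFiniteRank.add {f f' : Y × Z → M} (hf : HasFiniteRank F f) (hf' : HasFiniteRank F f') :
    HasFiniteRank F (f + f') := by
  obtain ⟨S, hS, hfS⟩ := hf
  obtain ⟨S', hS', hfS'⟩ := hf'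
  exact ⟨S ⊔ S', hS.sup hS', fun y => Submodule.add_mem_sup (hfS y) (hfS' y)⟩

lemma HasFiniteRank.smul {c : Y × Z → F} {f : Y × Z → M} (hc : HasFiniteRank F c)
    (hf : HasFiniteRank F f) : HasFiniteRank F (c • f) := by
  obtain ⟨S, hS, hcS⟩ := hc
  obtain ⟨S', hS', hfS'⟩ := hf
  exact ⟨Submodule.map₂ (Algebra.lsmul F F (Z → M)).toLinearMap S S', hS.map₂ _ hS',
    fun y => Submodule.apply_mem_map₂ _ (hcS y) (hfS' y)⟩

variable (F Y Z) in
/-- The algebra of scalar functions of finite rank. -/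
def finiteRank : Subalgebra F (Y × Z → F) where
  carrier := {c | HasFiniteRank F c}
  mul_mem' := .smul
  add_mem' := .add
  algebraMap_mem' c := .of_fst fun _ => c

variable (Y Z) in
/-- The functions of the form `A(y) + B(z)`. -/
def additivelySeparable (N : Type*) [AddCommMonoid N] : AddSubmonoid (Y × Z → N) where
  carrier := {L | ∃ (A : Y → N) (B : Z → N), ∀ x, L x = A x.1 + B x.2}
  zero_mem' := ⟨0, 0, fun x => by simp⟩
  add_mem' := by
    rintro _ _ ⟨A, B, h⟩ ⟨A', B', h'⟩
    exact ⟨A + A', B + B', fun x => by simp only [Pi.add_apply, h, h', add_add_add_comm]⟩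

lemma comp_mem_finiteRank {ι : Type*} {f : (ι → ℤ) → F} (hf : f ∈ expPolynomial F ι)
    {L : Y × Z → ι → ℤ} (hL : L ∈ additivelySeparable Y Z (ι → ℤ)) :
    f ∘ L ∈ finiteRank F Y Z := by
  obtain ⟨A, B, hAB⟩ := hL
  induction hf using Algebra.adjoin_induction with
  | mem f hf =>
    obtain ⟨i, rfl⟩ | ⟨⟨a, i⟩, rfl⟩ := hf
    · have h : (fun m : ι → ℤ => (m i : F)) ∘ L =
          (fun x => (A x.1 i : F)) + fun x => (B x.2 i : F) := by
        ext x
        simp [hAB]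
      exact h ▸ (HasFiniteRank.of_fst fun y => (A y i : F)).add (.of_snd fun z => (B z i : F))
    · have h : (fun m : ι → ℤ => (a : F) ^ m i) ∘ L =
          (fun x => (a : F) ^ A x.1 i) * fun x => (a : F) ^ B x.2 i := by
        ext x
        simp [hAB, zpow_add₀ a.ne_zero]
      exact h ▸ (HasFiniteRank.of_fst fun y => (a : F) ^ A y i).smul
        (.of_snd fun z => (a : F) ^ B z i)
  | algebraMap c => exact (finiteRank F Y Z).algebraMap_mem c
  | add f f' _ _ h h' => exact add_mem h h'
  | mul f f' _ _ h h' => exact mul_mem h h'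

lemma eval_mem_finiteRank {n : ℕ} (c : ExpPoly₂ F n)
    (L L' : additivelySeparable Y Z (Fin n → ℤ)) :
    (fun x => c.eval (L.1 x) (L'.1 x)) ∈ finiteRank F Y Z := by
  obtain ⟨⟨L, A, B, h⟩, ⟨L', A', B', h'⟩⟩ := L, L'
  refine comp_mem_finiteRank c.2 ⟨fun y => Sum.elim (A y) (A' y), fun z => Sum.elim (B z) (B' z),
    fun x => funext fun i => ?_⟩
  cases i <;> simp [h, h']

end FiniteRank

section Families

variable {F G : Type*} [Field F] [LieRing G] [LieAlgebra F G] {n : ℕ}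
  {𝒜 : (Fin n → ℤ) → Submodule F G} [GradedLieAlgebra 𝒜]
  {ℬ : ℤ → Submodule F G} [GradedLieAlgebra ℬ]
  {K : Type*} {g : K → (Fin n → ℤ) → G} {deg : K → ℤ}
  {V : Type*} [AddCommGroup V] [Module F V]
  [LieRingModule (zeroPart ℬ) V] [LieModule F (zeroPart ℬ) V]
  {J : Type*} {v : Module.Basis (J × (Fin n → ℤ)) F V}
  {X : Type*} {E : Subalgebra F (X → F)} {Λ : AddSubmonoid (X → Fin n → ℤ)}

variable (F g) in
/-- The family of elements `g_k(L(x))` of `U(G)`, for a family `L` of degrees. -/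
def operatorFamily (p : K × Λ) : X → UniversalEnvelopingAlgebra F G :=
  fun x => ι F (g p.1 (p.2.1 x))

variable (ℬ v E) in
/-- The `E`-span of the families `v_j(L(x))` in `V`, placed in degree `(0, L)`. -/
def zeroFamilies (e : ℤ × Λ) : Submodule E (X → MTilde ℬ V) :=
  Submodule.span E {w | e.1 = 0 ∧ ∃ j, w = fun x => Ind.incl (inflate ℬ V) (v (j, e.2.1 x))}

lemma IsExtragraded.operatorFamily_commutator_mem_span (hG : IsExtragraded 𝒜 ℬ g deg)
    (hE : ∀ (c : ExpPoly₂ F n) (L L' : Λ), (fun x => c.eval (L.1 x) (L'.1 x)) ∈ E)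
    (p q : K × Λ) :
    operatorFamily F g p * operatorFamily F g q - operatorFamily F g q * operatorFamily F g p ∈
      Submodule.span E (operatorFamily F g ''
        {r | Prod.map deg id r = Prod.map deg id p + Prod.map deg id q}) := by
  obtain ⟨f, hdeg, hf⟩ := hG.exists_homogeneous_structure p.1 q.1
  have hsum : operatorFamily F g p * operatorFamily F g q -
      operatorFamily F g q * operatorFamily F g p =
      f.sum fun s c => (⟨_, hE c p.2 q.2⟩ : E) • operatorFamily F g (s, p.2 + q.2) := by
    ext x
    change ι F (g p.1 (p.2.1 x)) * ι F (g q.1 (q.2.1 x)) -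
      ι F (g q.1 (q.2.1 x)) * ι F (g p.1 (p.2.1 x)) = _
    rw [← Ring.lie_def, ← LieHom.map_lie, hf, Finsupp.sum, Finsupp.sum, map_sum, Finset.sum_apply]
    exact Finset.sum_congr rfl fun s _ => map_smul _ _ _
  rw [hsum]
  exact Submodule.sum_mem _ fun s hs => Submodule.smul_mem _ _ <|
    Submodule.subset_span ⟨(s, p.2 + q.2), Prod.ext (hdeg s hs) rfl, rfl⟩

lemma IsExtragraded.operatorFamily_smul_mem_zeroFamilies (hG : IsExtragraded 𝒜 ℬ g deg)
    (hV : IsExpPolynomialModule (zeroSpanningSet ℬ hG.mem) v)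
    (hE : ∀ (c : ExpPoly₂ F n) (L L' : Λ), (fun x => c.eval (L.1 x) (L'.1 x)) ∈ E)
    {p : K × Λ} (hp : 0 ≤ deg p.1) {e : ℤ × Λ} {w : X → MTilde ℬ V}
    (hw : w ∈ zeroFamilies ℬ v E e) :
    operatorFamily F g p • w ∈ zeroFamilies ℬ v E (Prod.map deg id p + e) := by
  obtain ⟨h, hh⟩ := hV
  induction hw using Submodule.span_induction with
  | mem w hw =>
    obtain ⟨he, j, rfl⟩ := hw
    have happly : (operatorFamily F g p • fun x => Ind.incl (inflate ℬ V) (v (j, e.2.1 x))) =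
        fun x => Ind.incl (inflate ℬ V) ⁅zeroComponent ℬ (g p.1 (p.2.1 x)), v (j, e.2.1 x)⁆ :=
      funext fun x => ι_smul_incl_inflate hp (hG.mem p.1 _) _
    rw [happly]
    obtain hp | hp := hp.eq_or_lt
    · have hsum : (fun x => Ind.incl (inflate ℬ V)
          ⁅zeroComponent ℬ (g p.1 (p.2.1 x)), v (j, e.2.1 x)⁆) =
          (h ⟨p.1, hp.symm⟩ j).sum fun s c => (⟨_, hE c p.2 e.2⟩ : E) •
            fun x => Ind.incl (inflate ℬ V) (v (s, (p.2 + e.2).1 x)) := by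
        ext x
        rw [zeroComponent_eq_zeroSpanningSet hG.mem hp.symm, hh, Finsupp.sum, Finsupp.sum, map_sum,
          Finset.sum_apply]
        exact Finset.sum_congr rfl fun s _ => map_smul _ _ _
      rw [hsum]
      exact Submodule.sum_mem _ fun s _ => Submodule.smul_mem _ _ <| Submodule.subset_span
        ⟨by rw [Prod.fst_add, Prod.map_fst, ← hp, he, add_zero], s, rfl⟩
    · simp only [zeroComponent_of_mem_ne ℬ (hG.mem _ _) hp.ne', zero_lie, map_zero]
      exact Submodule.zero_mem _
  | zero => rw [smul_zero]; exact Submodule.zero_mem _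
  | add w w' _ _ hw hw' => rw [smul_add]; exact add_mem hw hw'
  | smul c w _ hw => rw [smul_comm _ c w]; exact Submodule.smul_mem _ c hw

lemma IsExtragraded.word_smul_mem_zeroFamilies (hG : IsExtragraded 𝒜 ℬ g deg)
    (hV : IsExpPolynomialModule (zeroSpanningSet ℬ hG.mem) v)
    (hE : ∀ (c : ExpPoly₂ F n) (L L' : Λ), (fun x => c.eval (L.1 x) (L'.1 x)) ∈ E)
    (l : List (K × Λ)) {e : ℤ × Λ} (he : 0 ≤ ((l.map (Prod.map deg id)).sum + e).1)
    {w : X → MTilde ℬ V} (hw : w ∈ zeroFamilies ℬ v E e) :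
    (l.map (operatorFamily F g)).prod • w ∈
      zeroFamilies ℬ v E ((l.map (Prod.map deg id)).sum + e) := by
  let N := normalForms (operatorFamily F g) (Prod.map deg id) {p : K × Λ | deg p.1 < 0}
    (zeroFamilies ℬ v E)
  have hW : ∀ p ∉ {p : K × Λ | deg p.1 < 0}, ∀ e, ∀ w ∈ zeroFamilies ℬ v E e,
      operatorFamily F g p • w ∈ zeroFamilies ℬ v E (Prod.map deg id p + e) :=
    fun p hp _ _ => hG.operatorFamily_smul_mem_zeroFamilies hV hE (not_lt.1 hp)
  have hN : ∀ p d, ∀ m ∈ N d, operatorFamily F g p • m ∈ N (Prod.map deg id p + d) :=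
    fun p _ _ => smul_mem_normalForms (hG.operatorFamily_commutator_mem_span hE) hW p
  have hbot : ∀ e : ℤ × Λ, 0 < e.1 → zeroFamilies ℬ v E e = ⊥ := fun e he => by
    rw [zeroFamilies, Submodule.span_eq_bot]
    exact fun w hw => absurd hw.1 he.ne'
  have hN_le : ∀ d : ℤ × Λ, 0 ≤ d.1 → N d ≤ zeroFamilies ℬ v E d := fun d hd =>
    normalForms_le_of_nonneg (a := operatorFamily F g) (wt := Prod.map deg id)
      (C := {p : K × Λ | deg p.1 < 0}) (φ := AddMonoidHom.fst ℤ Λ) (fun _ hp => hp) hbot hd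
  have hmem : w ∈ N e := le_normalForms e hw
  exact hN_le _ he (word_smul_mem_of_smul_mem (a := operatorFamily F g) hN l hmem)

end Families

section Words

variable {K : Type*} {deg : K → ℤ}

lemma finite_setOf_list_of_pos (hdeg : ∀ i, {k | deg k = i}.Finite) (m : ℤ) :
    {l : List K | (∀ k ∈ l, 0 < deg k) ∧ (l.map deg).sum = m}.Finite := by
  have hfinite : {k | 0 < deg k ∧ deg k ≤ m}.Finite :=
    ((Set.finite_Icc 0 m).biUnion fun i _ => hdeg i).subset fun k hk =>
      Set.mem_biUnion (x := deg k) ⟨hk.1.le, hk.2⟩ rfl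
  have : Finite {k | 0 < deg k ∧ deg k ≤ m} := hfinite
  refine ((List.finite_length_le {k | 0 < deg k ∧ deg k ≤ m} m.toNat).image
    (List.map Subtype.val)).subset ?_
  rintro l ⟨hl, hm⟩
  have hle : ∀ k ∈ l, deg k ≤ m := fun k hk => hm ▸
    List.single_le_sum (by simpa using fun k hk => (hl k hk).le) _ (List.mem_map_of_mem hk)
  have hlength : l.length ≤ m := by
    simpa [hm] using List.card_nsmul_le_sum (l.map deg) 1 (List.forall_mem_map.2 hl)
  lift l to List {k | 0 < deg k ∧ deg k ≤ m} using fun k hk => ⟨hl k hk, hle k hk⟩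
  rw [List.length_map] at hlength
  exact ⟨l, Int.le_toNat (by omega) |>.2 hlength, rfl⟩

lemma finite_setOf_list_of_neg (hdeg : ∀ i, {k | deg k = i}.Finite) (m : ℤ) :
    {l : List K | (∀ k ∈ l, deg k < 0) ∧ (l.map deg).sum = m}.Finite := by
  have h := finite_setOf_list_of_pos (deg := fun k => -deg k)
    (by simpa [neg_eq_iff_eq_neg] using fun i => hdeg (-i)) (-m)
  have hsum : ∀ l : List K, (l.map fun k => -deg k).sum = -(l.map deg).sum := fun l => by
    rw [List.sum_neg, List.map_map, Function.comp_def]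
  simpa only [neg_pos, hsum, neg_inj] using h

variable {A B C : Type*}

/-- The word with the type `κ = [κ_0, κ_1, …]` and the labels `z_0, z_1, …`. The labels are taken
from an infinite sequence in order that words of all types have the same parameter space. -/
def typedWord (κ : List A) (z : ℕ → B) : List (A × B) := κ.mapIdx fun t k => (k, z t)

lemma map_typedWord (f : B → C) (κ : List A) (z : ℕ → B) :
    (typedWord κ z).map (Prod.map id f) = typedWord κ (f ∘ z) :=
  List.ext_getElem (by simp [typedWord]) fun t _ _ => by simp [typedWord]

lemma map_fst_typedWord (κ : List A) (z : ℕ → B) : (typedWord κ z).map Prod.fst = κ :=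
  List.ext_getElem (by simp [typedWord]) fun t _ _ => by simp [typedWord]

lemma exists_typedWord_eq [Zero B] (l : List (A × B)) : ∃ z, typedWord (l.map Prod.fst) z = l :=
  ⟨fun t => (l.map Prod.snd).getD t 0, List.ext_getElem (by simp [typedWord]) fun t _ ht => by
    simp [typedWord, ht]⟩

lemma sum_map_weight [AddMonoid B] (deg : A → ℤ) (l : List (A × B)) :
    (l.map (Prod.map deg id)).sum = (((l.map Prod.fst).map deg).sum, (l.map Prod.snd).sum) := by
  induction l with
  | nil => rfl
  | cons p l ih => simp only [List.map_cons, List.sum_cons, ih, Prod.map, id, Prod.mk_add_mk]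

end Words

lemma finiteDimensional_map_of_inf_ker_le {F M P Q : Type*} [Field F] [AddCommGroup M] [Module F M]
    [AddCommGroup P] [Module F P] [AddCommGroup Q] [Module F Q] {W : Submodule F M}
    {S : Submodule F P} (hS : S.FG) (Ψ : M →ₗ[F] P) (q : M →ₗ[F] Q) (hW : W ≤ S.comap Ψ)
    (hker : W ⊓ LinearMap.ker Ψ ≤ LinearMap.ker q) : FiniteDimensional F (W.map q) := by
  have : FiniteDimensional F S := Module.Finite.iff_fg.2 hS
  let f : W →ₗ[F] S := (Ψ ∘ₗ W.subtype).codRestrict S fun w => hW w.2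
  have hf : LinearMap.ker f ≤ LinearMap.ker (q ∘ₗ W.subtype) := fun w hw =>
    hker ⟨w.2, congrArg Subtype.val (LinearMap.mem_ker.1 hw)⟩
  have : FiniteDimensional F (W ⧸ LinearMap.ker f) :=
    Module.Finite.equiv f.quotKerEquivRange.symm
  have h : W.map q = LinearMap.range ((LinearMap.ker f).liftQ _ hf) := by
    rw [Submodule.range_liftQ, LinearMap.range_comp, Submodule.range_subtype]
  rw [h]
  infer_instance

section FiniteDimensional

variable {F G : Type*} [Field F] [LieRing G] [LieAlgebra F G] {n : ℕ}
  {𝒜 : (Fin n → ℤ) → Submodule F G} [GradedLieAlgebra 𝒜]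
  {ℬ : ℤ → Submodule F G} [GradedLieAlgebra ℬ]
  {K : Type*} {g : K → (Fin n → ℤ) → G} {deg : K → ℤ}
  {V : Type*} [AddCommGroup V] [Module F V]
  [LieRingModule (zeroPart ℬ) V] [LieModule F (zeroPart ℬ) V]
  {J : Type*} {v : Module.Basis (J × (Fin n → ℤ)) F V}

variable (F g) in
/-- The monomial `g_{k_1}(α_1) ⋯ g_{k_s}(α_s)` of `U(G)`. -/
def monomial (l : List (K × (Fin n → ℤ))) : UniversalEnvelopingAlgebra F G :=
  (l.map fun p => ι F (Function.uncurry g p)).prod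

lemma monomial_append (l l' : List (K × (Fin n → ℤ))) :
    monomial F g (l ++ l') = monomial F g l * monomial F g l' := by
  rw [monomial, List.map_append, List.prod_append, monomial, monomial]

lemma prod_operatorFamily_apply {X : Type*} {Λ : AddSubmonoid (X → Fin n → ℤ)}
    (l : List (K × Λ)) (x : X) :
    (l.map (operatorFamily F g)).prod x = monomial F g (l.map (Prod.map id fun L => L.1 x)) := by
  rw [monomial, List.map_map]
  exact (map_list_prod (Pi.evalMonoidHom (fun _ => UniversalEnvelopingAlgebra F G) x) _).trans
    (congrArg List.prod (List.map_map ..))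

lemma sum_map_snd_apply {A X N : Type*} [AddCommMonoid N] {Λ : AddSubmonoid (X → N)}
    (l : List (A × Λ)) (x : X) :
    (l.map Prod.snd).sum.1 x = ((l.map (Prod.map id fun L => L.1 x)).map Prod.snd).sum := by
  rw [List.map_map]
  exact (map_list_sum ((Pi.evalAddMonoidHom _ x).comp Λ.subtype) _).trans
    (congrArg List.sum (List.map_map ..))

lemma hasFiniteRank_of_mem_zeroFamilies {Y Z : Type*}
    {e : ℤ × additivelySeparable Y Z (Fin n → ℤ)} {B : Z → Fin n → ℤ} (he : ∀ x, e.2.1 x = B x.2)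
    {w : Y × Z → MTilde ℬ V} (hw : w ∈ zeroFamilies ℬ v (finiteRank F Y Z) e) :
    HasFiniteRank F w := by
  induction hw using Submodule.span_induction with
  | mem w hw =>
    obtain ⟨-, j, rfl⟩ := hw
    simpa only [he] using .of_snd fun z => Ind.incl (inflate ℬ V) (v (j, B z))
  | zero => exact .of_snd 0
  | add w w' _ _ hw hw' => exact hw.add hw'
  | smul c w _ hw => exact .smul c.2 hw

lemma IsExtragraded.hasFiniteRank_monomial_smul (hG : IsExtragraded 𝒜 ℬ g deg)
    (hV : IsExpPolynomialModule (zeroSpanningSet ℬ hG.mem) v) {κ τ : List K}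
    (hdeg : (κ.map deg).sum + (τ.map deg).sum = 0) (j : J) (α : Fin n → ℤ) :
    HasFiniteRank F fun x : (ℕ → Fin n → ℤ) × (ℕ → Fin n → ℤ) =>
      monomial F g (typedWord κ x.2) • monomial F g (typedWord τ x.1) •
        Ind.incl (inflate ℬ V) (v (j, α - ((typedWord τ x.1).map Prod.snd).sum)) := by
  let Λ := additivelySeparable (ℕ → Fin n → ℤ) (ℕ → Fin n → ℤ) (Fin n → ℤ)
  let ζ : ℕ → Λ := fun t => ⟨fun x => x.2 t, 0, fun z => z t, fun x => by simp⟩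
  let η : ℕ → Λ := fun t => ⟨fun x => x.1 t, fun y => y t, 0, fun x => by simp⟩
  let B : Λ := ⟨fun x => α - ((typedWord τ x.1).map Prod.snd).sum,
    fun y => -((typedWord τ y).map Prod.snd).sum, fun _ => α, fun x => by ring⟩
  let l := typedWord κ ζ ++ typedWord τ η
  have hweight : (l.map (Prod.map deg id)).sum + (0, B) =
      (0, ((typedWord κ ζ).map Prod.snd).sum + ((typedWord τ η).map Prod.snd).sum + B) := by
    rw [sum_map_weight, List.map_append, List.map_append, List.map_append, List.sum_append,
      List.sum_append, map_fst_typedWord, map_fst_typedWord, hdeg, Prod.mk_add_mk, add_zero]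
  have hw : (fun x => Ind.incl (inflate ℬ V) (v (j, B.1 x))) ∈
      zeroFamilies ℬ v (finiteRank F _ _) (0, B) := Submodule.subset_span ⟨rfl, j, rfl⟩
  have hmem := hG.word_smul_mem_zeroFamilies hV eval_mem_finiteRank l (by rw [hweight]) hw
  rw [hweight] at hmem
  have hsum : ∀ x,
      (((typedWord κ ζ).map Prod.snd).sum + ((typedWord τ η).map Prod.snd).sum + B).1 x =
        ((typedWord κ x.2).map Prod.snd).sum + α := fun x => by
    change ((typedWord κ ζ).map Prod.snd).sum.1 x + ((typedWord τ η).map Prod.snd).sum.1 x +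
      (α - ((typedWord τ x.1).map Prod.snd).sum) = _
    rw [sum_map_snd_apply, sum_map_snd_apply, map_typedWord, map_typedWord]
    exact add_add_sub_cancel _ _ _
  have hrank := hasFiniteRank_of_mem_zeroFamilies
    (B := fun z => ((typedWord κ z).map Prod.snd).sum + α) hsum hmem
  convert hrank using 2 with x
  rw [Pi.smul_apply', prod_operatorFamily_apply, List.map_append, map_typedWord, map_typedWord,
    monomial_append, mul_smul]
  rfl

variable (ℬ g V) in
/-- The action on `M̃(V)` of all monomials whose factors have the given types. -/
def wordAction (κ : List K) : MTilde ℬ V →ₗ[F] (ℕ → Fin n → ℤ) → MTilde ℬ V :=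
  LinearMap.pi fun z => DistribSMul.toLinearMap F _ (monomial F g (typedWord κ z))

lemma IsExtragraded.component_le_span_monomial (hG : IsExtragraded 𝒜 ℬ g deg)
    (hV : IsExpPolynomialModule (zeroSpanningSet ℬ hG.mem) v) (i : ℤ) (α : Fin n → ℤ) :
    MTilde.component 𝒜 ℬ (moduleComponent v) (i, α) ≤
      Submodule.span F {m | ∃ (τ : List K) (y : ℕ → Fin n → ℤ) (j : J),
        (∀ k ∈ τ, deg k < 0) ∧ (τ.map deg).sum = i ∧ m = monomial F g (typedWord τ y) •
          Ind.incl (inflate ℬ V) (v (j, α - ((typedWord τ y).map Prod.snd).sum))} := by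
  refine (hG.component_le_normalForms hV (i, α)).trans (Submodule.span_le.2 ?_)
  rintro _ ⟨l, e, _, hl, ⟨y, hy, rfl⟩, hdeg, rfl⟩
  rw [bigradingModule_eq_span] at hy
  induction hy using Submodule.span_induction with
  | mem _ hy =>
    obtain ⟨⟨j, β⟩, rfl, rfl⟩ := hy
    obtain ⟨z, hz⟩ := exists_typedWord_eq l
    rw [sum_map_weight, Prod.mk_add_mk, add_zero, Prod.mk.injEq] at hdeg
    obtain ⟨hi, rfl⟩ := hdeg
    refine Submodule.subset_span ⟨l.map Prod.fst, z, j, List.forall_mem_map.2 hl, hi, ?_⟩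
    rw [hz, add_sub_cancel_left]
    rfl
  | zero => rw [map_zero, smul_zero]; exact Submodule.zero_mem _
  | add x y _ _ hx hy => rw [map_add, smul_add]; exact add_mem hx hy
  | smul c x _ hx => rw [map_smul, smul_comm _ c]; exact Submodule.smul_mem _ c hx

lemma IsExtragraded.exists_fg_map_wordAction_le [Finite J] (hG : IsExtragraded 𝒜 ℬ g deg)
    (hV : IsExpPolynomialModule (zeroSpanningSet ℬ hG.mem) v) {i : ℤ} (α : Fin n → ℤ) {κ : List K}
    (hκ : (κ.map deg).sum + i = 0) :
    ∃ S : Submodule F ((ℕ → Fin n → ℤ) → MTilde ℬ V), S.FG ∧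
      (MTilde.component 𝒜 ℬ (moduleComponent v) (i, α)).map (wordAction ℬ g V κ) ≤ S := by
  have : Finite {τ : List K | (∀ k ∈ τ, deg k < 0) ∧ (τ.map deg).sum = i} :=
    finite_setOf_list_of_neg hG.finite_deg i
  choose S hS hmem using
    fun (τ : {τ : List K | (∀ k ∈ τ, deg k < 0) ∧ (τ.map deg).sum = i}) (j : J) =>
      hG.hasFiniteRank_monomial_smul hV (κ := κ) (τ := τ.1) (by rw [τ.2.2, hκ]) j α
  refine ⟨⨆ τ, ⨆ j, S τ j, Submodule.fg_iSup _ fun τ => Submodule.fg_iSup _ (hS τ), ?_⟩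
  refine Submodule.map_le_iff_le_comap.2 <|
    (hG.component_le_span_monomial hV i α).trans (Submodule.span_le.2 ?_)
  rintro _ ⟨τ, y, j, hτ, hi, rfl⟩
  exact Submodule.mem_iSup_of_mem ⟨τ, hτ, hi⟩ (Submodule.mem_iSup_of_mem j (hmem ⟨τ, hτ, hi⟩ j y))

theorem IsExtragraded.finiteDimensional_mquot_component [Finite J]
    (hG : IsExtragraded 𝒜 ℬ g deg) (hV : IsExpPolynomialModule (zeroSpanningSet ℬ hG.mem) v)
    (γ : ℤ × (Fin n → ℤ)) :
    FiniteDimensional F (MQuot.component 𝒜 ℬ (moduleComponent v) γ) := by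
  obtain ⟨i, α⟩ := γ
  let T := {κ : List K | (∀ k ∈ κ, 0 < deg k) ∧ (κ.map deg).sum = -i}
  have : Finite T := finite_setOf_list_of_pos hG.finite_deg (-i)
  choose S hS hle using fun κ : T =>
    hG.exists_fg_map_wordAction_le hV α (κ := κ.1) (by rw [κ.2.2, neg_add_cancel])
  refine finiteDimensional_map_of_inf_ker_le (Submodule.fg_pi hS)
    (LinearMap.pi fun κ : T => wordAction ℬ g V κ.1) _
    (fun m hm κ _ => hle κ (Submodule.mem_map_of_mem hm)) fun m hm => ?_
  rw [LinearMap.ker_restrictScalars, Submodule.ker_mkQ]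
  refine hG.mem_rad_of_word_smul_eq_zero hV hm.1 fun l hl hdeg => ?_
  rw [sum_map_weight] at hdeg
  obtain ⟨z, hz⟩ := exists_typedWord_eq l
  have hzero := congrFun (congrFun hm.2 ⟨l.map Prod.fst, List.forall_mem_map.2 hl,
    eq_neg_of_add_eq_zero_left hdeg⟩) z
  rw [← hz]
  exact hzero

end FiniteDimensional

end ExpPolyLie

end

open ExpPolyLie in
theorem theorem1p5_general {F : Type*} [Field F]
    {G : Type*} [LieRing G] [LieAlgebra F G] {n : ℕ}
    (𝒜 : (Fin n → ℤ) → Submodule F G) [GradedLieAlgebra 𝒜]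
    (ℬ : ℤ → Submodule F G) [GradedLieAlgebra ℬ]
    {K : Type*} (g : K → (Fin n → ℤ) → G) (deg : K → ℤ)
    (hG : IsExtragraded 𝒜 ℬ g deg)
    {V : Type*} [AddCommGroup V] [Module F V]
    [LieRingModule (zeroPart ℬ) V] [LieModule F (zeroPart ℬ) V]
    {J : Type*} [Finite J] (v : Module.Basis (J × (Fin n → ℤ)) F V)
    (hV : IsExpPolynomialModule (zeroSpanningSet ℬ hG.mem) v) :
    IsGreatest {N | IsGradedAvoiding 𝒜 ℬ (moduleComponent v) N}
        (MTilde.rad 𝒜 ℬ (moduleComponent v)) ∧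
      DirectSum.IsInternal (MQuot.component 𝒜 ℬ (moduleComponent v)) ∧
      ∀ (i : ℤ) (α : Fin n → ℤ),
        FiniteDimensional F (MQuot.component 𝒜 ℬ (moduleComponent v) (i, α)) := by
  refine ⟨hG.isGreatest_rad hV, hG.isInternal_mquot_component hV, fun i α => ?_⟩
  exact hG.finiteDimensional_mquot_component hV (i, α)

open ExpPolyLie in
theorem theorem1p5 {F : Type*} [Field F] [CharZero F]
    {G : Type*} [LieRing G] [LieAlgebra F G] {n : ℕ}
    (𝒜 : (Fin n → ℤ) → Submodule F G) [GradedLieAlgebra 𝒜]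
    (ℬ : ℤ → Submodule F G) [GradedLieAlgebra ℬ]
    {K : Type*} (g : K → (Fin n → ℤ) → G) (deg : K → ℤ)
    (hG : IsExtragraded 𝒜 ℬ g deg)
    {V : Type*} [AddCommGroup V] [Module F V]
    [LieRingModule (zeroPart ℬ) V] [LieModule F (zeroPart ℬ) V]
    {J : Type*} [Finite J] (v : Module.Basis (J × (Fin n → ℤ)) F V)
    (hV : IsExpPolynomialModule (zeroSpanningSet ℬ hG.mem) v) :
    IsGreatest {N | IsGradedAvoiding 𝒜 ℬ (moduleComponent v) N}
        (MTilde.rad 𝒜 ℬ (moduleComponent v)) ∧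
      DirectSum.IsInternal (MQuot.component 𝒜 ℬ (moduleComponent v)) ∧
      ∀ (i : ℤ) (α : Fin n → ℤ),
        FiniteDimensional F (MQuot.component 𝒜 ℬ (moduleComponent v) (i, α)) := by
  exact theorem1p5_general 𝒜 ℬ g deg hG v hV
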